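/- Let $F$ be a field of characteristic $0$, let $H$ be an associative unital $F$-algebra, and let $L$ be a finite dimensional semisimple Lie algebra over $F$ with a generalized $H$-action, that is, a homomorphism of unital algebras $\rho\colon H\to \operatorname{End}_F(L)$ (write $ha=\rho(h)a$) such that for every $h\in H$ there are $h'_1,h''_1,\dots,h'_k,h''_k\in H$ with $h[a,b]=\sum_{i=1}^k[h'_ia,h''_ib]$ for all $a,b\in L$. Let $L(X\mid H)$ be the free Lie algebra on the symbols $x_j^{\gamma}$, where $j$ runs over the natural numbers and $\gamma$ over a basis of $H$; for $h=\sum_\gamma\alpha_\gamma\gamma$ put $x_j^h=\sum_\gamma\alpha_\gamma x_j^\gamma$. Let $\operatorname{Id}^H(L)$ be the ideal of those $f\in L(X\mid H)$ that vanish under all substitutions $x_j^h\mapsto h\,l_j$ with $l_j\in L$, and let $c_n^H(L)$ be the dimension of the image in $L(X\mid H)/\operatorname{Id}^H(L)$ of the span of all Lie monomials in which each of $n$ fixed variables occurs exactly once (with any exponent in $H$) and no other variable occurs. The $H$-exponent of $L$ is $\exp^H(L)=\lim_{n\to\infty}\sqrt[n]{c_n^H(L)}$, if the limit exists. A Lie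 algebra with a generalized $H$-action is called $H$-simple if it is non-abelian and $0$ and itself are its only $H$-invariant ideals. Assume that $L$ is $H$-semisimple: $L=L_1\oplus\dots\oplus L_m$, where the $L_i$ are $H$-invariant ideals of $L$ that are $H$-simple. Then: 1. $\exp^H(L)$ exists and is an integer (the analog of Amitsur's conjecture). 2. If $F$ is algebraically closed, then $\exp^H(L)=\max_{1\le i\le m}\dim_F L_i$. 3. More generally, the formula in 2 holds over any field $F$ of characteristic $0$ if, for every $i$, the only $F$-linear maps $L_i\to L_i$ that commute with $\operatorname{ad}(L_i)$ and with the action of $H$ are the multiplications by scalars from $F$. (For $L=0$, i.e. $m=0$, the maximum is read as $0$.) -/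

import Mathlib

namespace HLie

section Actions

variable {F L H : Type*} [Field F] [LieRing L] [LieAlgebra F L] [Ring H] [Algebra F H]

/-- A homomorphism `ρ : H → End_F(L)` of unital algebras is a generalized action of `H` on the
Lie algebra `L` if for every `h` there are finitely many `h'ᵢ, h''ᵢ` in `H` with
`h [a, b] = ∑ᵢ [h'ᵢ a, h''ᵢ b]` for all `a, b`. -/
def IsGeneralizedAction (ρ : H →ₐ[F] Module.End F L) : Prop :=
  ∀ h : H, ∃ (k : ℕ) (h' h'' : Fin k → H), ∀ a b : L,
    ρ h ⁅a, b⁆ = ∑ i, ⁅ρ (h' i) a, ρ (h'' i) b⁆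

/-- An ideal `I` is `H`-invariant if `H I ⊆ I`. -/
def IsHInvariant (ρ : H →ₐ[F] Module.End F L) (I : LieIdeal F L) : Prop :=
  ∀ (h : H) (a : L), a ∈ I → ρ h a ∈ I

/-- `L` is `H`-simple: non-abelian, and `0` and `L` are the only `H`-invariant ideals. -/
def IsHSimple (ρ : H →ₐ[F] Module.End F L) : Prop :=
  ¬ IsLieAbelian L ∧ ∀ I : LieIdeal F L, IsHInvariant ρ I → I = ⊥ ∨ I = ⊤

/-- Every linear endomorphism of `L` that commutes with the adjoint action of `L` and with the
action of `H` is multiplication by a scalar of `F`. -/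
def IsHCentral (ρ : H →ₐ[F] Module.End F L) : Prop :=
  ∀ T : Module.End F L, (∀ a b : L, T ⁅a, b⁆ = ⁅a, T b⁆) →
    (∀ (h : H) (a : L), T (ρ h a) = ρ h (T a)) →
    ∃ c : F, ∀ a : L, T a = c • a

/-- The action of `H` on an `H`-invariant ideal. -/
def restrictAction (ρ : H →ₐ[F] Module.End F L) (I : LieIdeal F L) (hI : IsHInvariant ρ I) :
    H →ₐ[F] Module.End F I :=
  AlgHom.ofLinearMap
    { toFun := fun h =>
        { toFun := fun a => ⟨ρ h a, hI h a a.2⟩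
          map_add' := fun a b => Subtype.ext (by simp)
          map_smul' := fun c a => Subtype.ext (by simp) }
      map_add' := fun h k => LinearMap.ext fun a => Subtype.ext (by simp)
      map_smul' := fun c h => LinearMap.ext fun a => Subtype.ext (by simp) }
    (LinearMap.ext fun a => Subtype.ext (by simp))
    (fun h k => LinearMap.ext fun a => Subtype.ext (by simp))

end Actions

section Polynomials

variable (F H : Type*) [Field F] [Ring H] [Algebra F H]

/-- The algebra `L(X | H)` of Lie `H`-polynomials in the variables `x₀, x₁, …`: the free Lie
algebra on the symbols `xᵢ^γ`, where `γ` runs over a fixed basis of `H`. -/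
abbrev HPoly : Type _ := FreeLieAlgebra F (ℕ × Module.Basis.ofVectorSpaceIndex F H)

variable {H}

/-- The element `xᵢ^h` for arbitrary `h` in `H`, by linear extension from the basis. -/
noncomputable def hvar (i : ℕ) (h : H) : HPoly F H :=
  Finsupp.linearCombination F
    (fun γ : Module.Basis.ofVectorSpaceIndex F H => FreeLieAlgebra.of F (i, γ))
    ((Module.Basis.ofVectorSpace F H).repr h)

/-- `f` is a multilinear Lie monomial in the variables `xᵢ`, `i ∈ s`: a bracket of elements
`xᵢ^h` (in any order and arrangement) in which every `i ∈ s` occurs exactly once. -/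
inductive IsMultilinearMonomial : Finset ℕ → HPoly F H → Prop
  | hvar (i : ℕ) (h : H) : IsMultilinearMonomial {i} (hvar F i h)
  | lie {s t : Finset ℕ} {f g : HPoly F H} (hst : Disjoint s t)
      (hf : IsMultilinearMonomial s f) (hg : IsMultilinearMonomial t g) :
      IsMultilinearMonomial (s ∪ t) ⁅f, g⁆

variable (H)

/-- The space `V_n^H` of multilinear Lie `H`-polynomials in the `n` variables `x₀, …, xₙ₋₁`. -/
noncomputable def multilinearPart (n : ℕ) : Submodule F (HPoly F H) :=
  Submodule.span F {f | IsMultilinearMonomial F (Finset.range n) f}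

variable {F H} {L : Type*} [LieRing L] [LieAlgebra F L]

/-- Evaluation of `H`-polynomials under the substitution `xᵢ ↦ φ i`, `xᵢ^γ ↦ γ (φ i)`. -/
noncomputable def evalAt (ρ : H →ₐ[F] Module.End F L) (φ : ℕ → L) : HPoly F H →ₗ⁅F⁆ L :=
  FreeLieAlgebra.lift F fun p => ρ (Module.Basis.ofVectorSpace F H p.2) (φ p.1)

theorem evalAt_hvar (ρ : H →ₐ[F] Module.End F L) (φ : ℕ → L) (i : ℕ) (h : H) :
    evalAt ρ φ (hvar F i h) = ρ h (φ i) := by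
  have key : (evalAt ρ φ : HPoly F H →ₗ[F] L) ∘ₗ
      (Finsupp.linearCombination F
        (fun γ : Module.Basis.ofVectorSpaceIndex F H => FreeLieAlgebra.of F (i, γ))) ∘ₗ
      ((Module.Basis.ofVectorSpace F H).repr : H →ₗ[F] _) =
      (LinearMap.applyₗ (φ i)) ∘ₗ ρ.toLinearMap := by
    refine (Module.Basis.ofVectorSpace F H).ext fun γ => ?_
    simp [evalAt, -Module.Basis.coe_ofVectorSpace]
  exact LinearMap.congr_fun key h

/-- The ideal `Id^H(L)` of `H`-identities of `L`: the `H`-polynomials that vanish under all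
substitutions of elements of `L`. -/
noncomputable def hIdentities (ρ : H →ₐ[F] Module.End F L) : LieIdeal F (HPoly F H) :=
  ⨅ φ : ℕ → L, (evalAt ρ φ).ker

/-- The codimension `c_n^H(L)`: the dimension of the image of `V_n^H` in the relatively free
algebra `L(X | H) / Id^H(L)`. -/
noncomputable def hCodim (ρ : H →ₐ[F] Module.End F L) (n : ℕ) : ℕ :=
  Module.finrank F ((multilinearPart F H n).map (hIdentities ρ).toSubmodule.mkQ)

/-- The `H`-exponent `lim (c_n^H(L))^(1/n)` of `L` exists and equals `d`. -/
def HasHExponent (ρ : H →ₐ[F] Module.End F L) (d : ℝ) : Prop :=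
  Filter.Tendsto (fun n : ℕ => (hCodim ρ n : ℝ) ^ (1 / (n : ℝ))) Filter.atTop (nhds d)

end Polynomials

end HLie

namespace HLie

open Finset Function Module Filter Topology

/-! The codimension is the dimension of the space of multilinear functions on `L` that
`H`-polynomials define, and for a direct sum of `H`-invariant ideals it lies between the largest
codimension of a summand and the sum of them all. So everything reduces to an `H`-simple `L`, where
Cartan's criterion supplies a nondegenerate Killing form.

Such an `L` is a simple module over the algebra generated by `ad L` and `H`. Its centroid `K` is a
field, and the exponent is `d = dim_K L`. The upper bound holds because a `K`-multilinear function
is determined by its values on a `K`-basis (`polyFun_finite_and_finrank_le`).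

For the lower bound, Jacobson density gives a nonzero polynomial function alternating in `d`
variables (`exists_isSeed`). Substituting double brackets into its determinant produces Killing
forms, and alternating these produces further pairs of determinants, as in Razmyslov's trick
(`IsSeed.killingForm_smul`, `IsSeed.det_mul_det_smul`). Hence products of arbitrarily many
determinants times one fixed nonzero function are polynomial functions. Arranging their variables as
tableaux with weighted boxes gives roughly `d ^ n` of them with a triangular matrix of values
(`linearIndependent_prod_det`, `card_balancedWords_pow_le_finrank`).

If `F` is algebraically closed, an eigenspace argument shows that the centroid consists of scalars,
so `d = dim_F L`. -/

theorem extend_update {ι M : Type*} [DecidableEq ι] {x : ι → ℕ} (hx : Injective x) (a : ι → M)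
    (φ : ℕ → M) (i : ι) (b : M) :
    extend x (update a i b) φ = update (extend x a φ) (x i) b := by
  ext j
  by_cases hj : ∃ k, x k = j
  · obtain ⟨k, rfl⟩ := hj
    by_cases hk : k = i
    · subst hk; simp [hx.extend_apply]
    · simp [hx.extend_apply, hk, hx.ne hk]
  · rw [extend_apply' _ _ _ hj, update_of_ne (fun h => hj ⟨i, h.symm⟩), extend_apply' _ _ _ hj]

/-! ### Multilinear `H`-polynomials as functions on `L`. -/

section PolynomialFunctions

variable {F L H : Type*} [Field F] [LieRing L] [LieAlgebra F L] [Ring H] [Algebra F H]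

/-- The functions `(ℕ → L) → L` given by multilinear Lie `H`-monomials in the variables `s`. -/
inductive IsMonomialFun (ρ : H →ₐ[F] Module.End F L) : Finset ℕ → ((ℕ → L) → L) → Prop
  | var (i : ℕ) (h : H) : IsMonomialFun ρ {i} fun φ => ρ h (φ i)
  | lie {s t : Finset ℕ} {f g : (ℕ → L) → L} (hst : Disjoint s t)
      (hf : IsMonomialFun ρ s f) (hg : IsMonomialFun ρ t g) :
      IsMonomialFun ρ (s ∪ t) fun φ => ⁅f φ, g φ⁆

theorem IsMultilinearMonomial.isMonomialFun (ρ : H →ₐ[F] Module.End F L) {s : Finset ℕ}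
    {f : HPoly F H} (hf : IsMultilinearMonomial F s f) :
    IsMonomialFun ρ s fun φ => evalAt ρ φ f := by
  induction hf with
  | hvar i h => simpa only [evalAt_hvar] using IsMonomialFun.var (ρ := ρ) i h
  | lie hst _ _ ihf ihg => simpa only [LieHom.map_lie] using IsMonomialFun.lie hst ihf ihg

theorem IsMonomialFun.exists_monomial {ρ : H →ₐ[F] Module.End F L} {s : Finset ℕ}
    {g : (ℕ → L) → L} (hg : IsMonomialFun ρ s g) :
    ∃ f : HPoly F H, IsMultilinearMonomial F s f ∧ (fun φ => evalAt ρ φ f) = g := by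
  induction hg with
  | var i h => exact ⟨_, .hvar i h, by simp only [evalAt_hvar]⟩
  | lie hst _ _ ihf ihg =>
    obtain ⟨f, hf, rfl⟩ := ihf
    obtain ⟨g, hg, rfl⟩ := ihg
    exact ⟨_, .lie hst hf hg, by simp only [LieHom.map_lie]⟩

theorem IsMonomialFun.congr {ρ : H →ₐ[F] Module.End F L} {s : Finset ℕ}
    {f : (ℕ → L) → L} (hf : IsMonomialFun ρ s f) {φ ψ : ℕ → L} (h : ∀ i ∈ s, φ i = ψ i) :
    f φ = f ψ := by
  induction hf with
  | var i h' => simp [h i (by simp)]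
  | lie _ _ _ ihf ihg =>
    simp only
    rw [ihf fun i hi => h i (by simp [hi]), ihg fun i hi => h i (by simp [hi])]

theorem IsMonomialFun.update_of_notMem {ρ : H →ₐ[F] Module.End F L} {s : Finset ℕ}
    {f : (ℕ → L) → L} (hf : IsMonomialFun ρ s f) {i : ℕ} (hi : i ∉ s) (φ : ℕ → L) (a : L) :
    f (update φ i a) = f φ :=
  hf.congr fun j hj => update_of_ne (fun h : j = i => hi (h ▸ hj)) _ _

theorem IsMonomialFun.rename {ρ : H →ₐ[F] Module.End F L} {s : Finset ℕ}
    {f : (ℕ → L) → L} (hf : IsMonomialFun ρ s f) {σ : ℕ → ℕ} (hσ : Set.InjOn σ s) :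
    IsMonomialFun ρ (s.image σ) fun φ => f (φ ∘ σ) := by
  induction hf with
  | var i h => simpa using IsMonomialFun.var (ρ := ρ) (σ i) h
  | @lie s t f g hst _ _ ihf ihg =>
    rw [image_union]
    refine IsMonomialFun.lie ?_ (ihf (hσ.mono (by simp))) (ihg (hσ.mono (by simp)))
    rw [Finset.disjoint_left]
    intro a ha hb
    obtain ⟨i, hi, rfl⟩ := mem_image.1 ha
    obtain ⟨j, hj, hji⟩ := mem_image.1 hb
    have : j = i := hσ (by simp [hj]) (by simp [hi]) hji
    exact Finset.disjoint_left.1 hst hi (this ▸ hj)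

variable (K : Type*) [Field K] [LieAlgebra K L]

/-- The `K`-span of the functions given by multilinear Lie `H`-monomials in the variables `s`. -/
def polyFun (ρ : H →ₐ[F] Module.End F L) (s : Finset ℕ) : Submodule K ((ℕ → L) → L) :=
  Submodule.span K {f | IsMonomialFun ρ s f}

variable {K} {ρ : H →ₐ[F] Module.End F L} {s t : Finset ℕ} {f g : (ℕ → L) → L}

theorem IsMonomialFun.mem_polyFun (hf : IsMonomialFun ρ s f) : f ∈ polyFun K ρ s :=
  Submodule.subset_span hf

theorem var_mem_polyFun (ρ : H →ₐ[F] Module.End F L) (i : ℕ) :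
    (fun φ => φ i) ∈ polyFun K ρ {i} := by
  simpa using (IsMonomialFun.var (ρ := ρ) i 1).mem_polyFun (K := K)

theorem lie_mem_polyFun (hst : Disjoint s t) (hf : f ∈ polyFun K ρ s) (hg : g ∈ polyFun K ρ t) :
    (fun φ => ⁅f φ, g φ⁆) ∈ polyFun K ρ (s ∪ t) := by
  induction hf, hg using Submodule.span_induction₂ with
  | mem_mem f g hf hg => exact (IsMonomialFun.lie hst hf hg).mem_polyFun
  | zero_left g hg => simp only [Pi.zero_apply, zero_lie]; exact zero_mem _
  | zero_right f hf => simp only [Pi.zero_apply, lie_zero]; exact zero_mem _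
  | add_left f f' g _ _ _ h h' => simpa [add_lie] using! add_mem h h'
  | add_right f g g' _ _ _ h h' => simpa [lie_add] using! add_mem h h'
  | smul_left c f g _ _ h => simpa [smul_lie] using! Submodule.smul_mem _ c h
  | smul_right c f g _ _ h => simpa [lie_smul] using! Submodule.smul_mem _ c h

/-- The generalized Leibniz rule pushes `h` through the brackets down to the variables, where it is
absorbed into the exponents. -/
theorem action_mem_polyFun (hρ : IsGeneralizedAction ρ)
    (hK : ∀ (h : H) (c : K) (a : L), ρ h (c • a) = c • ρ h a) (h : H)
    (hf : f ∈ polyFun K ρ s) : (fun φ => ρ h (f φ)) ∈ polyFun K ρ s := by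
  induction hf using Submodule.span_induction with
  | mem f hf =>
    simp only [Set.mem_ofPred_eq] at hf
    induction hf generalizing h with
    | var i h' => simpa using (IsMonomialFun.var (ρ := ρ) i (h * h')).mem_polyFun (K := K)
    | @lie s t f g hst _ _ ihf ihg =>
      obtain ⟨k, h', h'', hk⟩ := hρ h
      have : (fun φ => ρ h ⁅f φ, g φ⁆) = ∑ i, fun φ => ⁅ρ (h' i) (f φ), ρ (h'' i) (g φ)⁆ := by
        ext φ; simp [hk]
      rw [this]
      exact sum_mem fun i _ => lie_mem_polyFun hst (ihf _) (ihg _)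
  | zero => simp only [Pi.zero_apply, map_zero]; exact zero_mem _
  | add f g _ _ hf hg => simpa using! add_mem hf hg
  | smul c f _ hf => simpa [hK] using! Submodule.smul_mem _ c hf

theorem congr_of_mem_polyFun (hf : f ∈ polyFun K ρ s) {φ ψ : ℕ → L} (h : ∀ i ∈ s, φ i = ψ i) :
    f φ = f ψ := by
  induction hf using Submodule.span_induction with
  | mem f hf => exact IsMonomialFun.congr hf h
  | zero => rfl
  | add f g _ _ hf hg => simp [hf, hg]
  | smul c f _ hf => simp [hf]

theorem rename_mem_polyFun (hf : f ∈ polyFun K ρ s) {σ : ℕ → ℕ} (hσ : Set.InjOn σ s) :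
    (fun φ => f (φ ∘ σ)) ∈ polyFun K ρ (s.image σ) := by
  induction hf using Submodule.span_induction with
  | mem f hf => exact (IsMonomialFun.rename hf hσ).mem_polyFun
  | zero => exact (polyFun K ρ _).zero_mem
  | add f g _ _ hf hg => exact add_mem hf hg
  | smul c f _ hf => exact Submodule.smul_mem _ c hf

theorem subst_mem_polyFun (hρ : IsGeneralizedAction ρ)
    (hK : ∀ (h : H) (c : K) (a : L), ρ h (c • a) = c • ρ h a) {i : ℕ} (hi : i ∈ s)
    (hst : Disjoint (s.erase i) t) (hf : f ∈ polyFun K ρ s) (hg : g ∈ polyFun K ρ t) :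
    (fun φ => f (update φ i (g φ))) ∈ polyFun K ρ (s.erase i ∪ t) := by
  induction hf using Submodule.span_induction with
  | mem f hf =>
    simp only [Set.mem_ofPred_eq] at hf
    induction hf with
    | var j h =>
      obtain rfl : i = j := by simpa using hi
      simpa using action_mem_polyFun hρ hK h hg
    | @lie u v f₁ f₂ huv hf₁ hf₂ ih₁ ih₂ =>
      by_cases hu : i ∈ u
      · have hv : i ∉ v := Finset.disjoint_left.1 huv hu
        rw [erase_union_distrib, erase_eq_of_notMem hv] at hst ⊢
        rw [disjoint_union_left] at hst
        have := lie_mem_polyFun (K := K) ?_ (ih₁ hu hst.1) hf₂.mem_polyFun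
        · rw [union_right_comm]
          simpa only [hf₂.update_of_notMem hv] using this
        · rw [disjoint_union_left]
          exact ⟨huv.mono_left (erase_subset _ _), hst.2.symm⟩
      · have hv : i ∈ v := by simpa [hu] using hi
        rw [erase_union_distrib, erase_eq_of_notMem hu] at hst ⊢
        rw [disjoint_union_left] at hst
        have := lie_mem_polyFun (K := K) ?_ hf₁.mem_polyFun (ih₂ hv hst.2)
        · rw [union_assoc]
          simpa only [hf₁.update_of_notMem hu] using this
        · rw [disjoint_union_right]
          exact ⟨huv.mono_right (erase_subset _ _), hst.1⟩
  | zero => exact (polyFun K ρ _).zero_mem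
  | add f g _ _ hf hg => exact add_mem hf hg
  | smul c f _ hf => exact Submodule.smul_mem _ c hf

theorem isLinearMap_of_mem_polyFun (hK : ∀ (h : H) (c : K) (a : L), ρ h (c • a) = c • ρ h a)
    {i : ℕ} (hi : i ∈ s) (hf : f ∈ polyFun K ρ s) (φ : ℕ → L) :
    IsLinearMap K fun a => f (update φ i a) := by
  induction hf using Submodule.span_induction with
  | mem f hf =>
    simp only [Set.mem_ofPred_eq] at hf
    induction hf with
    | var j h =>
      obtain rfl : i = j := by simpa using hi
      exact ⟨by simp, by simp [hK]⟩
    | @lie u v f₁ f₂ huv hf₁ hf₂ ih₁ ih₂ =>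
      by_cases hu : i ∈ u
      · have hv : i ∉ v := Finset.disjoint_left.1 huv hu
        exact ⟨fun a b => by simp [hf₂.update_of_notMem hv, (ih₁ hu).map_add],
          fun c a => by simp [hf₂.update_of_notMem hv, (ih₁ hu).map_smul]⟩
      · have hv : i ∈ v := by simpa [hu] using hi
        exact ⟨fun a b => by simp [hf₁.update_of_notMem hu, (ih₂ hv).map_add],
          fun c a => by simp [hf₁.update_of_notMem hu, (ih₂ hv).map_smul]⟩
  | zero => exact ⟨by simp, by simp⟩
  | add f g _ _ hf hg =>
    exact ⟨fun a b => by simp only [Pi.add_apply, hf.map_add, hg.map_add]; abel,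
      fun c a => by simp [hf.map_smul, hg.map_smul]⟩
  | smul c f _ hf =>
    exact ⟨fun a b => by simp [hf.map_add], fun r a => by simp [hf.map_smul, smul_comm c r]⟩

/-- A function in `polyFun K ρ s` as a multilinear map in the variables `x i`, the others being
fixed to the values of `φ`. -/
noncomputable def toMultilinearMap (hK : ∀ (h : H) (c : K) (a : L), ρ h (c • a) = c • ρ h a)
    (hf : f ∈ polyFun K ρ s) {ι : Type*} (x : ι → ℕ) (hx : Injective x)
    (hxs : ∀ i, x i ∈ s) (φ : ℕ → L) : MultilinearMap K (fun _ : ι => L) L where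
  toFun a := f (extend x a φ)
  map_update_add' a i b c := by
    simp only [extend_update hx]
    exact (isLinearMap_of_mem_polyFun hK (hxs i) hf _).map_add b c
  map_update_smul' a i c b := by
    simp only [extend_update hx]
    exact (isLinearMap_of_mem_polyFun hK (hxs i) hf _).map_smul c b

theorem toMultilinearMap_apply (hK : ∀ (h : H) (c : K) (a : L), ρ h (c • a) = c • ρ h a)
    (hf : f ∈ polyFun K ρ s) {ι : Type*} (x : ι → ℕ) (hx : Injective x)
    (hxs : ∀ i, x i ∈ s) (φ : ℕ → L) (a : ι → L) :
    toMultilinearMap hK hf x hx hxs φ a = f (extend x a φ) := rfl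

/-- Evaluation of `H`-polynomials as a linear map to functions on substitutions. -/
noncomputable def evalLinear (ρ : H →ₐ[F] Module.End F L) : HPoly F H →ₗ[F] ((ℕ → L) → L) :=
  LinearMap.pi fun φ => (evalAt ρ φ : HPoly F H →ₗ[F] L)

theorem map_evalLinear_multilinearPart (ρ : H →ₐ[F] Module.End F L) (n : ℕ) :
    (multilinearPart F H n).map (evalLinear ρ) = polyFun F ρ (range n) := by
  rw [multilinearPart, Submodule.map_span, polyFun]
  congr 1
  ext g
  constructor
  · rintro ⟨f, hf, rfl⟩
    exact hf.isMonomialFun ρ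
  · intro hg
    exact hg.exists_monomial

/-- The identities are exactly the kernel of evaluation, so free Lie algebras can be left aside and
only functions on `L` counted. -/
theorem hCodim_eq_finrank_polyFun (ρ : H →ₐ[F] Module.End F L) (n : ℕ) :
    hCodim ρ n = Module.finrank F (polyFun F ρ (range n)) := by
  have hker : (hIdentities ρ).toSubmodule = LinearMap.ker (evalLinear ρ) := by
    ext f
    simp [hIdentities, evalLinear, LinearMap.mem_ker, funext_iff]
  have hinj : Injective ((hIdentities ρ).toSubmodule.liftQ (evalLinear ρ) hker.le) := by
    rw [← LinearMap.ker_eq_bot, Submodule.ker_liftQ_eq_bot _ _ _ hker.ge]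
  rw [hCodim, ← map_evalLinear_multilinearPart,
    ← Submodule.liftQ_mkQ (hIdentities ρ).toSubmodule (evalLinear ρ) hker.le, Submodule.map_comp]
  exact (Submodule.equivMapOfInjective _ hinj _).finrank_eq

end PolynomialFunctions

/-! ### Determinants, traces and bilinear forms. -/

section Determinants

variable {K V : Type*} [Field K] [AddCommGroup V] [Module K V] {d : ℕ} (e : Basis (Fin d) K V)

/-- The determinant is infinitesimally multiplied by the trace. -/
theorem sum_det_update_eq_trace_mul_det (T : V →ₗ[K] V) (a : Fin d → V) :
    ∑ i, e.det (update a i (T (a i))) = LinearMap.trace K V T * e.det a := by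
  have hT : ∀ i, (e.repr (T (a i)) : Fin d → K) =
      ((LinearMap.toMatrix e e T * e.toMatrix a).col i) := by
    intro i
    ext k
    rw [← LinearMap.toMatrix_mulVec_repr e e T (a i)]
    rfl
  have h : ∀ i, e.det (update a i (T (a i))) =
      ((e.toMatrix a).adjugate * (LinearMap.toMatrix e e T * e.toMatrix a)) i i := by
    intro i
    rw [Basis.det_apply, Basis.toMatrix_update, ← Matrix.cramer_apply,
      Matrix.cramer_eq_adjugate_mulVec, hT]
    rfl
  rw [sum_congr rfl fun i _ => h i, LinearMap.trace_eq_matrix_trace K e, Basis.det_apply]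
  change Matrix.trace _ = _
  rw [Matrix.trace_mul_comm, Matrix.mul_assoc, Matrix.mul_adjugate, Matrix.mul_smul,
    Matrix.mul_one, Matrix.trace_smul, smul_eq_mul, mul_comm]

theorem det_bilinForm_apply (B : LinearMap.BilinForm K V) (a b : Fin d → V) :
    (Matrix.of fun i j => B (a i) (b j)).det =
      (LinearMap.BilinForm.toMatrix e B).det * (e.det a * e.det b) := by
  have : (Matrix.of fun i j => B (a i) (b j)) =
      (e.toMatrix a).transpose * LinearMap.BilinForm.toMatrix e B * e.toMatrix b := by
    ext i j
    rw [Matrix.of_apply, LinearMap.BilinForm.apply_eq_dotProduct_toMatrix_mulVec e,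
      Matrix.mul_assoc]
    rfl
  rw [this, Matrix.det_mul, Matrix.det_mul, Matrix.det_transpose, Basis.det_apply,
    Basis.det_apply]
  ring

theorem alternatingMap_apply_eq_det_smul {V' : Type*} [AddCommGroup V'] [Module K V']
    (f : V [⋀^Fin d]→ₗ[K] V') (a : Fin d → V) : f a = e.det a • f e := by
  -- Functionals reduce the claim to scalar-valued alternating maps, which are multiples of the
  -- determinant.
  rw [← sub_eq_zero, ← Module.forall_dual_apply_eq_zero_iff K]
  intro l
  have := congrArg (fun q => q a) ((l.compAlternatingMap f).eq_smul_basis_det e)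
  simp only [LinearMap.compAlternatingMap_apply, AlternatingMap.smul_apply, smul_eq_mul] at this
  rw [map_sub, this, map_smul, smul_eq_mul, mul_comm, sub_self]

end Determinants

/-! ### Multiplying a seed by Killing forms and determinants. -/

section Seeds

variable {F K L H : Type*} [Field F] [LieRing L] [LieAlgebra F L] [Ring H] [Algebra F H]
  [Field K] [LieAlgebra K L] {ρ : H →ₐ[F] Module.End F L} {d : ℕ} {e : Basis (Fin d) K L}

/-- The function `g`, depending only on the variables in `t`, becomes a multilinear
`H`-polynomial when multiplied by the determinant in the variables `x`. -/
structure IsSeed (ρ : H →ₐ[F] Module.End F L) (e : Basis (Fin d) K L) (x : Fin d → ℕ)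
    (t : Finset ℕ) (g : (ℕ → L) → L) : Prop where
  inj : Injective x
  notMem : ∀ i, x i ∉ t
  mem : (fun φ => e.det (φ ∘ x) • g φ) ∈ polyFun K ρ (univ.image x ∪ t)
  congr : ∀ {φ ψ : ℕ → L}, (∀ i ∈ t, φ i = ψ i) → g φ = g ψ

variable {x : Fin d → ℕ} {t : Finset ℕ} {g : (ℕ → L) → L}

theorem IsSeed.rename (h : IsSeed ρ e x t g) {σ : ℕ → ℕ}
    (hσ : Set.InjOn σ (univ.image x ∪ t : Finset ℕ)) :
    IsSeed ρ e (σ ∘ x) (t.image σ) fun φ => g (φ ∘ σ) where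
  inj i j hij := h.inj (hσ (by simp) (by simp) hij)
  notMem i hi := by
    obtain ⟨j, hj, hji⟩ := mem_image.1 hi
    have : j = x i := hσ (by simp [hj]) (by simp) hji
    exact h.notMem i (this ▸ hj)
  mem := by
    have := rename_mem_polyFun h.mem hσ
    rwa [image_union, image_image] at this
  congr hφ := h.congr fun i hi => hφ _ (mem_image_of_mem _ hi)

theorem IsSeed.lie (h : IsSeed ρ e x t g) {j : ℕ} (hj : j ∉ univ.image x ∪ t) :
    IsSeed ρ e x (insert j t) fun φ => ⁅φ j, g φ⁆ where
  inj := h.inj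
  notMem i hi := by
    rcases mem_insert.1 hi with hi | hi
    · exact hj (by simp [← hi])
    · exact h.notMem i hi
  mem := by
    have := lie_mem_polyFun (disjoint_singleton_left.2 hj) (var_mem_polyFun ρ j) h.mem
    simp only [lie_smul] at this
    rwa [union_left_comm, ← insert_eq] at this
  congr {φ ψ} hφ := by
    rw [hφ j (by simp), h.congr fun i hi => hφ i (by simp [hi])]

/-- Replace `x i` by `⁅u, ⁅v, x i⁆⁆` and sum over `i`. As `g` does not involve the `x i`, only the
determinant changes, and it is multiplied by the trace of `ad u ∘ ad v`, the Killing form. -/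
theorem IsSeed.killingForm_smul (hρ : IsGeneralizedAction ρ)
    (hK : ∀ (h : H) (c : K) (a : L), ρ h (c • a) = c • ρ h a)
    (h : IsSeed ρ e x t g) {u v : ℕ} (hu : u ∉ univ.image x ∪ t) (hv : v ∉ univ.image x ∪ t)
    (huv : u ≠ v) :
    IsSeed ρ e x (insert u (insert v t)) fun φ => killingForm K L (φ u) (φ v) • g φ where
  inj := h.inj
  notMem i hi := by
    simp only [mem_insert] at hi
    rcases hi with hi | hi | hi
    · exact hu (by simp [← hi])
    · exact hv (by simp [← hi])
    · exact h.notMem i hi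
  congr {φ ψ} hφ := by
    rw [hφ u (by simp), hφ v (by simp), h.congr fun i hi => hφ i (by simp [hi])]
  mem := by
    have hset : ∀ i : Fin d, (univ.image x ∪ t).erase (x i) ∪ ({u} ∪ ({v} ∪ {x i})) =
        univ.image x ∪ insert u (insert v t) := by
      intro i
      ext j
      simp only [mem_union, mem_erase, mem_image, mem_univ, true_and, mem_insert, mem_singleton]
      by_cases hj : j = x i
      · simp [hj]
      · simp only [hj, ne_eq, not_false_eq_true, true_and, or_false]
        tauto
    have hterm : ∀ i : Fin d, (fun φ : ℕ → L =>
        e.det (update φ (x i) ⁅φ u, ⁅φ v, φ (x i)⁆⁆ ∘ x) •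
          g (update φ (x i) ⁅φ u, ⁅φ v, φ (x i)⁆⁆)) ∈
        polyFun K ρ (univ.image x ∪ insert u (insert v t)) := by
      intro i
      have hxu : x i ≠ u := fun hi => hu (by simp [← hi])
      have hxv : x i ≠ v := fun hi => hv (by simp [← hi])
      have hg := lie_mem_polyFun (K := K) (s := {u}) (t := {v} ∪ {x i}) (by simp [huv, hxu.symm])
        (var_mem_polyFun ρ u)
        (lie_mem_polyFun (by simp [hxv.symm]) (var_mem_polyFun ρ v) (var_mem_polyFun ρ (x i)))
      have := subst_mem_polyFun hρ hK (i := x i) (by simp) ?_ h.mem hg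
      · rwa [hset i] at this
      · rw [Finset.disjoint_left]
        intro j hj hj'
        simp only [mem_union, mem_singleton] at hj'
        rcases hj' with rfl | rfl | rfl
        · exact hu (mem_of_mem_erase hj)
        · exact hv (mem_of_mem_erase hj)
        · simp at hj
    have hsum := sum_mem fun i (_ : i ∈ univ) => hterm i
    convert hsum using 1
    ext φ
    have hg : ∀ (i : Fin d) (a : L), g (update φ (x i) a) = g φ := fun i a =>
      h.congr fun j hj => update_of_ne (fun hji : j = x i => h.notMem i (hji ▸ hj)) _ _
    have hx : ∀ (i : Fin d) (a : L), update φ (x i) a ∘ x = update (φ ∘ x) i a := fun i a =>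
      update_comp_eq_of_injective φ h.inj i a
    have htr := sum_det_update_eq_trace_mul_det e
      (LieAlgebra.ad K L (φ u) ∘ₗ LieAlgebra.ad K L (φ v)) (φ ∘ x)
    simp only [LinearMap.comp_apply, LieAlgebra.ad_apply, comp_apply] at htr
    rw [Finset.sum_apply]
    simp only [hg, hx, ← sum_smul, htr, killingForm_apply_apply, smul_smul]
    rw [mul_comm]

theorem IsSeed.prod_killingForm_smul (hρ : IsGeneralizedAction ρ)
    (hK : ∀ (h : H) (c : K) (a : L), ρ h (c • a) = c • ρ h a)
    (h : IsSeed ρ e x t g) {ι : Type*} [DecidableEq ι] {u v : ι → ℕ} (hu : Injective u)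
    (hv : Injective v)
    (hut : ∀ i, u i ∉ univ.image x ∪ t) (hvt : ∀ i, v i ∉ univ.image x ∪ t)
    (huv : ∀ i j, u i ≠ v j) (S : Finset ι) :
    IsSeed ρ e x (S.image u ∪ S.image v ∪ t)
      fun φ => (∏ i ∈ S, killingForm K L (φ (u i)) (φ (v i))) • g φ := by
  induction S using Finset.induction_on with
  | empty => simpa using h
  | @insert i S hi ih =>
    have := ih.killingForm_smul hρ hK (u := u i) (v := v i) ?_ ?_ (huv i i)
    · simp only [prod_insert hi, mul_smul]
      convert this using 1
      ext j
      simp only [image_insert, mem_union, mem_insert]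
      tauto
    · have := hut i
      simp only [mem_union, not_or, mem_image, not_exists, not_and] at this ⊢
      exact ⟨this.1, ⟨fun k hk hki => hi (hu hki ▸ hk), fun k _ hki => huv i k hki.symm⟩, this.2⟩
    · have := hvt i
      simp only [mem_union, not_or, mem_image, not_exists, not_and] at this ⊢
      exact ⟨this.1, ⟨fun k _ hki => huv k i hki, fun k hk hki => hi (hv hki ▸ hk)⟩, this.2⟩

/-- The signed sum over `σ` of the products of Killing forms of `u i` and `v (σ i)` is a
determinant. It equals the product of the two wanted determinants and the Gram determinant of the
Killing form, which is nonzero. -/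
theorem IsSeed.det_mul_det_smul (hρ : IsGeneralizedAction ρ)
    (hK : ∀ (h : H) (c : K) (a : L), ρ h (c • a) = c • ρ h a)
    (hκ : (killingForm K L).Nondegenerate)
    (h : IsSeed ρ e x t g) {u v : Fin d → ℕ} (hu : Injective u) (hv : Injective v)
    (hut : ∀ i, u i ∉ univ.image x ∪ t) (hvt : ∀ i, v i ∉ univ.image x ∪ t)
    (huv : ∀ i j, u i ≠ v j) :
    IsSeed ρ e x (univ.image u ∪ univ.image v ∪ t)
      fun φ => (e.det (φ ∘ u) * e.det (φ ∘ v)) • g φ := by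
  have hseed := fun σ : Equiv.Perm (Fin d) => h.prod_killingForm_smul hρ hK hu
    (hv.comp σ.injective) hut (fun i => hvt (σ i)) (fun i j => huv i (σ j)) univ
  have himage : ∀ σ : Equiv.Perm (Fin d), univ.image (v ∘ σ) = univ.image v := by
    intro σ
    rw [← image_image, image_univ_equiv]
  simp only [himage] at hseed
  refine ⟨h.inj, (hseed 1).notMem, ?_, fun {φ ψ} hφ => ?_⟩
  · have hsum := sum_mem fun σ (_ : σ ∈ (univ : Finset (Equiv.Perm (Fin d)))) =>
      Submodule.smul_mem _ (((Equiv.Perm.sign σ : ℤˣ) : ℤ) : K) (hseed σ).mem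
    have hG : (LinearMap.BilinForm.toMatrix e (killingForm K L)).det ≠ 0 :=
      (LinearMap.BilinForm.nondegenerate_iff_det_ne_zero e).1 hκ
    rw [← Submodule.smul_mem_iff _ hG]
    convert hsum using 1
    ext φ
    have hdet := det_bilinForm_apply e (killingForm K L) (φ ∘ u) (φ ∘ v)
    rw [← Matrix.det_transpose, Matrix.det_apply'] at hdet
    simp only [Matrix.transpose_apply, Matrix.of_apply, comp_apply] at hdet
    simp only [Finset.sum_apply, Pi.smul_apply, comp_apply, smul_smul, ← sum_smul]
    congr 1
    rw [mul_left_comm, ← hdet, mul_sum]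
    exact sum_congr rfl fun σ _ => by ring
  · have h1 : φ ∘ u = ψ ∘ u := funext fun i => hφ _ (by simp)
    have h2 : φ ∘ v = ψ ∘ v := funext fun i => hφ _ (by simp)
    rw [h1, h2, h.congr fun i hi => hφ i (by simp [hi])]

end Seeds

/-! ### Existence of a seed, by density. -/

section SeedExistence

variable {F K L H : Type*} [Field F] [LieRing L] [LieAlgebra F L] [Ring H] [Algebra F H]
  [Field K] [LieAlgebra K L] {ρ : H →ₐ[F] Module.End F L} {d : ℕ} {e : Basis (Fin d) K L}

/-- The algebra of operators on `L` generated by the adjoint action of `L` and the action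
of `H`. -/
def multiplicationAlgebra (ρ : H →ₐ[F] Module.End F L) : Subalgebra F (Module.End F L) :=
  Algebra.adjoin F (Set.range (LieAlgebra.ad F L) ∪ Set.range ρ)

variable (K) in
/-- The span of the functions obtained from `H`-polynomials in the variables `0, …, k - 1` and
further variables outside `0, …, d - 1`, by fixing the values of the latter. -/
def specializedFun (ρ : H →ₐ[F] Module.End F L) (d k : ℕ) : Submodule K ((ℕ → L) → L) :=
  Submodule.span K {p | ∃ (t : Finset ℕ) (f : (ℕ → L) → L) (φ : ℕ → L), Disjoint (range d) t ∧
    f ∈ polyFun K ρ (range k ∪ t) ∧ p = fun ψ => f ((range k).piecewise ψ φ)}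

variable {k : ℕ} {p : (ℕ → L) → L}

theorem const_mem_specializedFun (ρ : H →ₐ[F] Module.End F L) (d : ℕ) (a : L) :
    (fun _ => a) ∈ specializedFun K ρ d 0 :=
  Submodule.subset_span ⟨{d}, fun φ => φ d, fun _ => a, by simp,
    by simpa using var_mem_polyFun ρ d, by ext; simp [Finset.piecewise]⟩

theorem action_mem_specializedFun (hρ : IsGeneralizedAction ρ)
    (hK : ∀ (h : H) (c : K) (a : L), ρ h (c • a) = c • ρ h a) (h : H)
    (hp : p ∈ specializedFun K ρ d k) : (fun ψ => ρ h (p ψ)) ∈ specializedFun K ρ d k := by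
  induction hp using Submodule.span_induction with
  | mem p hp =>
    obtain ⟨t, f, φ, ht, hf, rfl⟩ := hp
    exact Submodule.subset_span ⟨t, _, φ, ht, action_mem_polyFun hρ hK h hf, rfl⟩
  | zero => simp only [Pi.zero_apply, map_zero]; exact zero_mem _
  | add f g _ _ hf hg => simpa using! add_mem hf hg
  | smul c f _ hf => simpa [hK] using! Submodule.smul_mem _ c hf

/-- The constant `a` enters as the prescribed value of a fresh variable. -/
theorem lie_const_mem_specializedFun (hkd : k ≤ d) (a : L) (hp : p ∈ specializedFun K ρ d k) :
    (fun ψ => ⁅a, p ψ⁆) ∈ specializedFun K ρ d k := by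
  induction hp using Submodule.span_induction with
  | mem p hp =>
    obtain ⟨t, f, φ, ht, hf, rfl⟩ := hp
    obtain ⟨j, hj⟩ := Infinite.exists_notMem_finset (range d ∪ t)
    rw [notMem_union, mem_range] at hj
    have hjk : j ∉ range k ∪ t := by
      rw [notMem_union, mem_range]
      exact ⟨fun h => hj.1 (h.trans_le hkd), hj.2⟩
    refine Submodule.subset_span ⟨insert j t, fun φ => ⁅φ j, f φ⁆, update φ j a, ?_, ?_, ?_⟩
    · rw [disjoint_insert_right, mem_range]
      exact ⟨hj.1, ht⟩
    · have := lie_mem_polyFun (disjoint_singleton_left.2 hjk) (var_mem_polyFun ρ j) hf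
      rwa [union_left_comm, ← insert_eq] at this
    · ext ψ
      have hjr : j ∉ range k := fun h => hjk (mem_union_left _ h)
      simp only [piecewise_eq_of_notMem _ _ _ hjr, update_self]
      congr 1
      refine congr_of_mem_polyFun hf fun i hi => ?_
      by_cases hik : i ∈ range k
      · simp only [piecewise_eq_of_mem _ _ _ hik]
      · simp only [piecewise_eq_of_notMem _ _ _ hik]
        rw [update_of_ne fun h : i = j => hjk (h ▸ hi)]
  | zero => simp only [Pi.zero_apply, lie_zero]; exact zero_mem _
  | add f g _ _ hf hg => simpa using! add_mem hf hg
  | smul c f _ hf => simpa using! Submodule.smul_mem _ c hf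

theorem mul_mem_specializedFun (hρ : IsGeneralizedAction ρ)
    (hK : ∀ (h : H) (c : K) (a : L), ρ h (c • a) = c • ρ h a) (hkd : k ≤ d)
    {T : Module.End F L} (hT : T ∈ multiplicationAlgebra ρ) :
    ∀ {p : (ℕ → L) → L}, p ∈ specializedFun K ρ d k →
      (fun ψ => T (p ψ)) ∈ specializedFun K ρ d k := by
  induction hT using Algebra.adjoin_induction with
  | mem T hT =>
    rcases hT with ⟨a, rfl⟩ | ⟨h, rfl⟩
    · exact lie_const_mem_specializedFun hkd a
    · exact action_mem_specializedFun hρ hK h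
  | algebraMap c =>
    rw [← ρ.commutes]
    exact action_mem_specializedFun hρ hK _
  | add S T _ _ hS hT => exact fun hp => add_mem (hS hp) (hT hp)
  | mul S T _ _ hS hT => exact fun hp => hS (hT hp)

theorem lie_var_mem_specializedFun (hkd : k < d) (hp : p ∈ specializedFun K ρ d k) :
    (fun ψ => ⁅ψ k, p ψ⁆) ∈ specializedFun K ρ d (k + 1) := by
  induction hp using Submodule.span_induction with
  | mem p hp =>
    obtain ⟨t, f, φ, ht, hf, rfl⟩ := hp
    have hkt : k ∉ range k ∪ t := by
      rw [notMem_union]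
      exact ⟨by simp, Finset.disjoint_left.1 ht (mem_range.2 hkd)⟩
    refine Submodule.subset_span ⟨t, fun φ => ⁅φ k, f φ⁆, φ, ht, ?_, ?_⟩
    · have := lie_mem_polyFun (disjoint_singleton_left.2 hkt) (var_mem_polyFun ρ k) hf
      rwa [← union_assoc, ← insert_eq, ← range_add_one] at this
    · ext ψ
      simp only [piecewise_eq_of_mem _ _ _ (self_mem_range_succ k)]
      congr 1
      refine congr_of_mem_polyFun hf fun i hi => ?_
      by_cases hik : i ∈ range k
      · rw [piecewise_eq_of_mem _ _ _ hik,
          piecewise_eq_of_mem _ _ _ (range_subset_range.2 k.le_succ hik)]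
      · have hik' : i ∉ range (k + 1) := by
          rw [range_add_one, mem_insert, not_or]
          exact ⟨fun h => hkt (h ▸ hi), hik⟩
        rw [piecewise_eq_of_notMem _ _ _ hik, piecewise_eq_of_notMem _ _ _ hik']
  | zero => simp only [Pi.zero_apply, lie_zero]; exact zero_mem _
  | add f g _ _ hf hg => simpa using! add_mem hf hg
  | smul c f _ hf => simpa using! Submodule.smul_mem _ c hf

/-- Nondegeneracy writes `l k` as the Killing form with some `u`, hence as a sum over `j` of the
coordinates `e.coord j ⁅u, ⁅ψ k, e j⁆⁆`. By density the multiplication algebra contains the rank one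
operator `x ↦ e.coord j ⁅u, x⁆ • v`. It is applied to the bracket of `ψ k` with the function that
induction provides for `e j`. -/
theorem prod_dual_smul_mem_specializedFun (hρ : IsGeneralizedAction ρ)
    (hK : ∀ (h : H) (c : K) (a : L), ρ h (c • a) = c • ρ h a)
    (hκ : (killingForm K L).Nondegenerate)
    (hdense : ∀ T : Module.End K L, ∃ T' ∈ multiplicationAlgebra ρ, ∀ a, T' a = T a)
    (e : Basis (Fin d) K L) (l : ℕ → Dual K L) (hkd : k ≤ d) (v : L) :
    (fun ψ => (∏ i ∈ range k, l i (ψ i)) • v) ∈ specializedFun K ρ d k := by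
  have := e.finiteDimensional_of_finite
  induction k generalizing v with
  | zero => simpa using const_mem_specializedFun ρ d v
  | succ k ih =>
    obtain ⟨u, hu⟩ : ∃ u : L, ∀ a, l k a = killingForm K L u a :=
      ⟨(LinearMap.BilinForm.toDual (killingForm K L) hκ).symm (l k), fun a =>
        (LinearMap.BilinForm.apply_toDual_symm_apply ..).symm⟩
    have hterm : ∀ j : Fin d, (fun ψ : ℕ → L =>
        e.coord j ⁅u, ⁅ψ k, (∏ i ∈ range k, l i (ψ i)) • e j⁆⁆ • v) ∈
        specializedFun K ρ d (k + 1) := by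
      intro j
      obtain ⟨T, hT, hT'⟩ := hdense (((e.coord j).comp (LieAlgebra.ad K L u)).smulRight v)
      have := mul_mem_specializedFun hρ hK hkd hT
        (lie_var_mem_specializedFun hkd (ih (Nat.le_of_succ_le hkd) (e j)))
      simpa [hT', mul_smul] using this
    convert sum_mem fun j (_ : j ∈ univ) => hterm j using 1
    ext ψ
    rw [prod_range_succ, Finset.sum_apply, hu, killingForm_apply_apply,
      LinearMap.trace_eq_matrix_trace K e, Matrix.trace, ← sum_smul]
    congr 1
    rw [mul_sum]
    refine sum_congr rfl fun j _ => ?_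
    simp [LinearMap.toMatrix_apply]

theorem exists_isSeed (hρ : IsGeneralizedAction ρ)
    (hK : ∀ (h : H) (c : K) (a : L), ρ h (c • a) = c • ρ h a)
    (hκ : (killingForm K L).Nondegenerate)
    (hdense : ∀ T : Module.End K L, ∃ T' ∈ multiplicationAlgebra ρ, ∀ a, T' a = T a)
    [Nontrivial L] (e : Basis (Fin d) K L) :
    ∃ (t : Finset ℕ) (g : (ℕ → L) → L), IsSeed ρ e Fin.val t g ∧ ∃ φ, g φ ≠ 0 := by
  obtain ⟨v, hv⟩ := exists_ne (0 : L)
  -- Alternation in the first `d` variables, evaluated at the basis. It is `K`-linear and takes the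
  -- product of the coordinate functions, times `v`, to `v ≠ 0`, so it cannot kill every spanning
  -- function.
  let A : ((ℕ → L) → L) → L := fun p =>
    ∑ σ : Equiv.Perm (Fin d), Equiv.Perm.sign σ • p (extend Fin.val (e ∘ σ) 0)
  have hA : ∃ p ∈ {p | ∃ (t : Finset ℕ) (f : (ℕ → L) → L) (φ : ℕ → L), Disjoint (range d) t ∧
      f ∈ polyFun K ρ (range d ∪ t) ∧ p = fun ψ => f ((range d).piecewise ψ φ)}, A p ≠ 0 := by
    by_contra! hA
    have hzero : ∀ p ∈ specializedFun K ρ d d, A p = 0 := by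
      intro p hp
      induction hp using Submodule.span_induction with
      | mem p hp => exact hA p hp
      | zero => simp [A]
      | add p q _ _ hp hq => simpa [A, sum_add_distrib, hp] using hq
      | smul c p _ hp =>
        have : A (c • p) = c • A p := by
          simp only [A, Pi.smul_apply, smul_sum]
          exact sum_congr rfl fun σ _ => smul_comm _ _ _
        rw [this, hp, smul_zero]
    let l : ℕ → Dual K L := fun i => if h : i < d then e.coord ⟨i, h⟩ else 0
    refine hv ?_
    rw [← hzero _ (prod_dual_smul_mem_specializedFun hρ hK hκ hdense e l le_rfl v)]
    have hprod : ∀ σ : Equiv.Perm (Fin d),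
        ∏ i ∈ range d, l i (extend Fin.val (e ∘ σ) 0 i) = if σ = 1 then 1 else 0 := by
      intro σ
      have : ∏ i ∈ range d, l i (extend Fin.val (e ∘ σ) 0 i) =
          ∏ i : Fin d, if σ i = i then (1 : K) else 0 := by
        rw [Finset.prod_range]
        refine prod_congr rfl fun i _ => ?_
        rw [Fin.val_injective.extend_apply]
        simp [l, Finsupp.single_apply]
      rw [this]
      split_ifs with h
      · simp [h]
      · obtain ⟨i, hi⟩ : ∃ i, σ i ≠ i := by
          by_contra! h'
          exact h (Equiv.ext h')
        exact prod_eq_zero (mem_univ i) (if_neg hi)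
    simp only [A, hprod]
    rw [Finset.sum_eq_single 1 (fun σ _ hσ => by simp [hσ]) (by simp)]
    simp
  obtain ⟨p, ⟨t, f, φ, ht, hf, rfl⟩, hp⟩ := hA
  have hxs : ∀ i : Fin d, (i : ℕ) ∈ range d ∪ t := fun i => by simp
  let M : (ℕ → L) → L [⋀^Fin d]→ₗ[K] L := fun φ =>
    (toMultilinearMap hK hf Fin.val Fin.val_injective hxs φ).alternatization
  have hM : ∀ φ a, M φ a = ∑ σ : Equiv.Perm (Fin d),
      Equiv.Perm.sign σ • f (extend Fin.val (a ∘ σ) φ) := by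
    intro φ a
    simp only [M, MultilinearMap.alternatization_apply, MultilinearMap.domDomCongr_apply,
      toMultilinearMap_apply]
    rfl
  have himage : univ.image (Fin.val : Fin d → ℕ) = range d := by
    ext j
    simp only [mem_image, mem_univ, true_and, mem_range]
    exact ⟨fun ⟨i, hi⟩ => hi ▸ i.2, fun h => ⟨⟨j, h⟩, rfl⟩⟩
  refine ⟨t, fun φ => M φ e, ⟨Fin.val_injective, fun i => Finset.disjoint_left.1 ht (by simp),
    ?_, fun {φ ψ} h => ?_⟩, φ, ?_⟩
  -- Since `d = dim_K L`, an alternating map in `d` variables is the determinant times its value at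
  -- the basis.
  · have hdet : (fun φ : ℕ → L => e.det (φ ∘ Fin.val) • M φ e) = fun φ => M φ (φ ∘ Fin.val) :=
      funext fun φ => (alternatingMap_apply_eq_det_smul e (M φ) _).symm
    rw [hdet, himage]
    simp only [hM]
    have hterm : ∀ σ : Equiv.Perm (Fin d),
        (fun φ : ℕ → L => f (extend Fin.val ((φ ∘ Fin.val) ∘ σ) φ)) ∈
          polyFun K ρ (range d ∪ t) := by
      intro σ
      -- Each term of the alternation is `f` with its variables renamed by `τ`, which acts as `σ` on
      -- the first `d` indices and fixes the others.
      let τ : ℕ → ℕ := extend Fin.val (Fin.val ∘ σ) id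
      have hτ : ∀ i : Fin d, τ i = σ i := fun i => Fin.val_injective.extend_apply _ _ _
      have hτ' : ∀ j, ¬ j < d → τ j = j := fun j hj =>
        extend_apply' _ _ _ fun ⟨i, hi⟩ => hj (hi ▸ i.2)
      have hτinj : Injective τ := by
        intro i j hij
        by_cases hi : i < d <;> by_cases hj : j < d
        · have h1 := hτ ⟨i, hi⟩
          have h2 := hτ ⟨j, hj⟩
          simp only at h1 h2
          rw [h1, h2, Fin.val_inj, σ.apply_eq_iff_eq, Fin.mk.injEq] at hij
          exact hij
        · have h1 := hτ ⟨i, hi⟩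
          simp only at h1
          rw [h1, hτ' j hj] at hij
          exact absurd (σ ⟨i, hi⟩).2 (hij ▸ hj)
        · have h1 := hτ ⟨j, hj⟩
          simp only at h1
          rw [h1, hτ' i hi] at hij
          exact absurd (σ ⟨j, hj⟩).2 (hij ▸ hi)
        · rwa [hτ' i hi, hτ' j hj] at hij
      have hset : (range d ∪ t).image τ = range d ∪ t := by
        refine eq_of_subset_of_card_le (fun j hj => ?_) (card_image_of_injective _ hτinj).ge
        obtain ⟨i, hi, rfl⟩ := mem_image.1 hj
        by_cases hid : i < d
        · have h1 := hτ ⟨i, hid⟩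
          simp only at h1
          simp [h1]
        · rwa [hτ' i hid]
      have := rename_mem_polyFun hf (σ := τ) hτinj.injOn
      rw [hset] at this
      convert this using 3
      ext j
      by_cases hj : j < d
      · have h1 := hτ ⟨j, hj⟩
        have h2 := Fin.val_injective.extend_apply ((‹ℕ → L› ∘ Fin.val) ∘ σ) ‹ℕ → L› ⟨j, hj⟩
        simp only at h1 h2
        rw [h2, comp_apply, comp_apply, comp_apply, h1]
      · rw [comp_apply, hτ' j hj, extend_apply' _ _ _ fun ⟨i, hi⟩ => hj (hi ▸ i.2)]
    convert sum_mem fun σ (_ : σ ∈ (univ : Finset (Equiv.Perm (Fin d)))) =>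
      Submodule.smul_mem _ (((Equiv.Perm.sign σ : ℤˣ) : ℤ) : K) (hterm σ) using 1
    ext φ
    simp only [Finset.sum_apply, Pi.smul_apply]
    refine sum_congr rfl fun σ _ => ?_
    rw [Int.cast_smul_eq_zsmul]
    rfl
  · simp only [hM]
    refine sum_congr rfl fun σ _ => congrArg _ (congr_of_mem_polyFun hf fun j hj => ?_)
    by_cases hjd : ∃ i : Fin d, (i : ℕ) = j
    · obtain ⟨i, rfl⟩ := hjd
      rw [Fin.val_injective.extend_apply, Fin.val_injective.extend_apply]
    · rw [extend_apply' _ _ _ hjd, extend_apply' _ _ _ hjd]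
      rcases mem_union.1 hj with hj | hj
      · exact absurd ⟨⟨j, mem_range.1 hj⟩, rfl⟩ hjd
      · exact h j hj
  · simp only [hM]
    intro h0
    refine hp (Eq.trans ?_ h0)
    refine sum_congr rfl fun σ _ => congrArg _ (congrArg f ?_)
    ext j
    by_cases hj : j < d
    · have h1 := fun ψ : ℕ → L => Fin.val_injective.extend_apply (e ∘ σ) ψ ⟨j, hj⟩
      simp only at h1
      rw [piecewise_eq_of_mem _ _ _ (mem_range.2 hj), h1, h1]
    · rw [piecewise_eq_of_notMem _ _ _ (by simpa using hj),
        extend_apply' _ _ _ fun ⟨i, hi⟩ => hj (hi ▸ i.2)]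

end SeedExistence

/-! ### Products of arbitrarily many determinants. -/

section MultialternatingPolynomials

variable {F K L H : Type*} [Field F] [LieRing L] [LieAlgebra F L] [Ring H] [Algebra F H]
  [Field K] [LieAlgebra K L] {ρ : H →ₐ[F] Module.End F L} {d : ℕ} {e : Basis (Fin d) K L}

theorem exists_lie_ne_zero (hκ : (killingForm K L).Nondegenerate) {b : L} (hb : b ≠ 0) :
    ∃ a : L, ⁅a, b⁆ ≠ 0 := by
  by_contra! h
  refine hb (hκ.1 b fun a => ?_)
  have : LieAlgebra.ad K L b = 0 := by
    ext c
    rw [LieAlgebra.ad_apply, ← lie_skew, h c, neg_zero]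
    rfl
  rw [killingForm_apply_apply, this, LinearMap.zero_comp, map_zero]

/-- Bracketing with a new variable enlarges a seed by one variable and keeps it nonzero because `L`
has trivial centre. This lets the number of variables run through all large `n`. -/
theorem exists_isSeed_of_card (hρ : IsGeneralizedAction ρ)
    (hK : ∀ (h : H) (c : K) (a : L), ρ h (c • a) = c • ρ h a)
    (hκ : (killingForm K L).Nondegenerate)
    (hdense : ∀ T : Module.End K L, ∃ T' ∈ multiplicationAlgebra ρ, ∀ a, T' a = T a)
    [Nontrivial L] (e : Basis (Fin d) K L) :
    ∃ s₀ : ℕ, ∀ S : Finset ℕ, s₀ ≤ S.card → ∃ (x : Fin d → ℕ) (t : Finset ℕ)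
      (g : (ℕ → L) → L), IsSeed ρ e x t g ∧ univ.image x ∪ t = S ∧ ∃ φ, g φ ≠ 0 := by
  obtain ⟨t, g, hg, φ₀, hφ₀⟩ := exists_isSeed hρ hK hκ hdense e
  refine ⟨(univ.image (Fin.val : Fin d → ℕ) ∪ t).card, fun S hS => ?_⟩
  induction hn : S.card - (univ.image (Fin.val : Fin d → ℕ) ∪ t).card generalizing S with
  | zero =>
    have hcard : (univ.image (Fin.val : Fin d → ℕ) ∪ t).card = S.card := by omega
    obtain ⟨σ, hσ⟩ : ∃ σ : ℕ → ℕ,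
        Set.BijOn σ (univ.image (Fin.val : Fin d → ℕ) ∪ t : Finset ℕ) S := by
      refine Set.Finite.exists_bijOn_of_encard_eq (finite_toSet _) ?_
      simp only [Set.encard_coe_eq_coe_finsetCard, hcard]
    refine ⟨_, _, _, hg.rename hσ.injOn, ?_,
      φ₀ ∘ invFunOn σ (univ.image (Fin.val : Fin d → ℕ) ∪ t : Finset ℕ), ?_⟩
    · rw [← image_image, ← image_union, ← coe_inj, coe_image]
      exact hσ.image_eq
    · refine ne_of_eq_of_ne (hg.congr fun i hi => ?_) hφ₀
      simp only [comp_apply]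
      rw [hσ.injOn.leftInvOn_invFunOn (by simp [hi])]
  | succ n ih =>
    obtain ⟨j, hj⟩ : S.Nonempty := by
      rw [← card_pos]
      omega
    have hc := card_erase_of_mem hj
    obtain ⟨x, t', g', hg', hS', φ, hφ⟩ := ih (S.erase j) (by omega) (by omega)
    have hjS : j ∉ univ.image x ∪ t' := by simp [hS']
    obtain ⟨a, ha⟩ := exists_lie_ne_zero hκ hφ
    refine ⟨x, insert j t', _, hg'.lie hjS, ?_, update φ j a, ?_⟩
    · rw [insert_eq, union_left_comm, hS', ← insert_eq, insert_erase hj]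
    · rw [update_self, hg'.congr (ψ := φ) fun i hi =>
        update_of_ne (fun h : i = j => hjS (mem_union_right _ (h ▸ hi))) _ _]
      exact ha

/-- Determinants are created two at a time, whence the even cardinality. -/
theorem IsSeed.prod_det_smul (hρ : IsGeneralizedAction ρ)
    (hK : ∀ (h : H) (c : K) (a : L), ρ h (c • a) = c • ρ h a)
    (hκ : (killingForm K L).Nondegenerate) {x : Fin d → ℕ} {t : Finset ℕ} {g : (ℕ → L) → L}
    (h : IsSeed ρ e x t g) {J : Type*} [DecidableEq J] {c : J × Fin d → ℕ} (hc : Injective c)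
    (hct : ∀ p, c p ∉ univ.image x ∪ t) (k : ℕ) (S : Finset J) (hS : S.card = 2 * k) :
    IsSeed ρ e x ((S ×ˢ univ).image c ∪ t)
      fun φ => (∏ j ∈ S, e.det fun r => φ (c (j, r))) • g φ := by
  induction k generalizing S with
  | zero =>
    obtain rfl : S = ∅ := card_eq_zero.1 hS
    simpa using h
  | succ k ih =>
    obtain ⟨i, S', hi, rfl, hS'⟩ := card_eq_succ.1 (show S.card = (2 * k + 1) + 1 by omega)
    obtain ⟨j, S, hj, rfl, hcard⟩ := card_eq_succ.1 hS'
    have hij : i ≠ j := fun h => hi (by simp [h])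
    have hiS : i ∉ S := fun h => hi (by simp [h])
    have hfresh : ∀ j' ∉ S, ∀ r : Fin d, c (j', r) ∉ univ.image x ∪ ((S ×ˢ univ).image c ∪ t) := by
      intro j' hj' r
      have := hct (j', r)
      simp only [mem_union, not_or] at this ⊢
      refine ⟨this.1, fun hm => ?_, this.2⟩
      obtain ⟨⟨j'', r'⟩, hm, hr⟩ := mem_image.1 hm
      have := hc hr
      simp only [Prod.mk.injEq] at this
      exact hj' (this.1 ▸ (mem_product.1 hm).1)
    have := (ih S hcard).det_mul_det_smul hρ hK hκ (u := fun r => c (i, r)) (v := fun r => c (j, r))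
      (fun a b hab => by simpa using hc hab) (fun a b hab => by simpa using hc hab)
      (hfresh i hiS) (hfresh j hj) (fun a b hab => hij (by simpa using congrArg Prod.fst (hc hab)))
    convert this using 1
    · ext n
      simp only [mem_union, mem_image, mem_product, mem_insert, mem_univ, and_true, true_and,
        Prod.exists]
      constructor
      · rintro (⟨a, b, rfl | rfl | ha, rfl⟩ | hn)
        · exact Or.inl (Or.inl ⟨b, rfl⟩)
        · exact Or.inl (Or.inr ⟨b, rfl⟩)
        · exact Or.inr (Or.inl ⟨a, b, ha, rfl⟩)
        · exact Or.inr (Or.inr hn)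
      · rintro ((⟨b, rfl⟩ | ⟨b, rfl⟩) | ⟨a, b, ha, rfl⟩ | hn)
        · exact Or.inl ⟨i, b, by simp, rfl⟩
        · exact Or.inl ⟨j, b, by simp, rfl⟩
        · exact Or.inl ⟨a, b, by simp [ha], rfl⟩
        · exact Or.inr hn
    · ext φ
      rw [prod_insert hi, prod_insert hj, ← mul_assoc, mul_smul]
      rfl

/-- There are `H`-polynomials that are products of arbitrarily many determinants with a fixed
nonzero function. -/
theorem exists_prod_det_smul_mem_polyFun (hρ : IsGeneralizedAction ρ)
    (hK : ∀ (h : H) (c : K) (a : L), ρ h (c • a) = c • ρ h a)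
    (hκ : (killingForm K L).Nondegenerate)
    (hdense : ∀ T : Module.End K L, ∃ T' ∈ multiplicationAlgebra ρ, ∀ a, T' a = T a)
    [Nontrivial L] (e : Basis (Fin d) K L) :
    ∃ s₀ : ℕ, ∀ S : Finset ℕ, s₀ ≤ S.card → ∃ G : (ℕ → L) → L,
      (∀ {φ ψ : ℕ → L}, (∀ i ∈ S, φ i = ψ i) → G φ = G ψ) ∧ (∃ φ, G φ ≠ 0) ∧
      ∀ {J : Type} [Fintype J] [DecidableEq J] {c : J × Fin d → ℕ}, Injective c →
        (∀ p, c p ∉ S) → Even (Fintype.card J) →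
        (fun φ => (∏ j, e.det fun r => φ (c (j, r))) • G φ) ∈
          polyFun K ρ (univ.image c ∪ S) := by
  obtain ⟨s₀, hs₀⟩ := exists_isSeed_of_card hρ hK hκ hdense e
  refine ⟨s₀, fun S hS => ?_⟩
  obtain ⟨x, t, g, hg, rfl, φ, hφ⟩ := hs₀ S hS
  -- The determinant of the seed itself is absorbed into `G`.
  refine ⟨fun φ => e.det (φ ∘ x) • g φ, fun {φ ψ} h => congr_of_mem_polyFun hg.mem h,
    ⟨extend x e φ, ?_⟩, ?_⟩
  · have h1 : extend x e φ ∘ x = e := funext fun i => hg.inj.extend_apply _ _ _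
    have h2 : g (extend x e φ) = g φ := hg.congr fun i hi =>
      extend_apply' _ _ _ fun ⟨j, hj⟩ => hg.notMem j (hj ▸ hi)
    simp only [h1, h2, e.det_self, one_smul]
    exact hφ
  · intro J _ _ c hc hct hJ
    obtain ⟨k, hk⟩ := hJ
    have := (hg.prod_det_smul hρ hK hκ hc hct k univ (by rw [card_univ]; omega)).mem
    rw [univ_product_univ, union_left_comm] at this
    convert this using 2
    rw [smul_comm]

end MultialternatingPolynomials

/-! ### Independence of products of determinants. -/

section Independence

variable {K V : Type*} [Field K] [AddCommGroup V] [Module K V]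

/-- Functions whose matrix of values at suitable points is triangular are independent. -/
theorem linearIndependent_of_triangular {ι X : Type*} [Finite ι] (f : ι → X → V) (x : ι → X)
    (w : ι → ℕ) (hdiag : ∀ i, f i (x i) ≠ 0)
    (htri : ∀ i j, f i (x j) ≠ 0 → j = i ∨ w j < w i) : LinearIndependent K f := by
  have := Fintype.ofFinite ι
  rw [Fintype.linearIndependent_iff]
  intro c hc
  by_contra! h
  obtain ⟨i₀, hi₀⟩ := h
  -- At the point of an index of maximal weight in the relation, all other terms of the relation
  -- vanish.
  obtain ⟨i, hi, hmax⟩ := Set.exists_max_image {i | c i ≠ 0} w (Set.toFinite _) ⟨i₀, hi₀⟩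
  have hval := congrFun hc (x i)
  rw [Finset.sum_apply, Finset.sum_eq_single i] at hval
  · exact (smul_ne_zero hi (hdiag i)) hval
  · intro j _ hji
    by_cases hcj : c j = 0
    · simp [hcj]
    · rw [Pi.smul_apply]
      by_contra hne
      rcases htri j i (fun h0 => hne (by rw [h0, smul_zero])) with h1 | h1
      · exact hji h1.symm
      · exact absurd (hmax j hcj) (not_le.2 h1)
  · simp

/-- This is the strict rearrangement inequality: equality would make `τ` monotone, and the only
order automorphism of `Fin d` is the identity. -/
theorem sum_mul_lt_of_strictMono {d : ℕ} {h : Fin d → ℕ} (hh : StrictMono h) {τ : Fin d → Fin d}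
    (hτ : Injective τ) (hne : τ ≠ id) : ∑ r, h r * (τ r : ℕ) < ∑ r, h r * (r : ℕ) := by
  let σ : Equiv.Perm (Fin d) := Equiv.ofBijective τ (Finite.injective_iff_bijective.1 hτ)
  have hmono : Monovary h (fun r : Fin d => (r : ℕ)) := fun i j hij =>
    hh.monotone (le_of_lt (by exact_mod_cast hij))
  refine (hmono.sum_mul_comp_perm_lt_sum_mul_iff (σ := σ)).2 fun hmv => hne ?_
  have hσ : Monotone τ := by
    intro i j hij
    by_contra! hlt
    have := hmv (i := j) (j := i) (by exact_mod_cast hlt)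
    have hji := hh.le_iff_le.1 this
    exact absurd hlt (by rw [le_antisymm hij hji]; exact lt_irrefl _)
  have hsm : StrictMono τ := hσ.strictMono_of_injective hτ
  ext r : 1
  have := Subsingleton.elim
    (StrictMono.orderIsoOfSurjective τ hsm (Finite.injective_iff_surjective.1 hτ))
    (OrderIso.refl (Fin d))
  exact congrArg (fun q : Fin d ≃o Fin d => q r) this

/-- If the columns of the fillings `c` have strictly increasing weights and the corresponding
words differ, the products of determinants of the columns are independent. -/
theorem linearIndependent_prod_det {ι J P : Type*} [Finite ι] [Fintype J] [Fintype P]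
    {d : ℕ} (e : Basis (Fin d) K V) (h : P → ℕ) (c : ι → J × Fin d ≃ P)
    (hmono : ∀ α j, StrictMono fun r => h (c α (j, r)))
    (hword : Injective fun α p => ((c α).symm p).2) (q : P → ℕ) (hq : Injective q)
    (G : (ℕ → V) → V) (φ : ℕ → V) (hφ : G φ ≠ 0)
    (hG : ∀ ψ : ℕ → V, (∀ i, i ∉ Set.range q → ψ i = φ i) → G ψ = G φ) :
    LinearIndependent K fun (α : ι) (ψ : ℕ → V) =>
      (∏ j, e.det fun r => ψ (q (c α (j, r)))) • G ψ := by
  -- The word of a filling records the row of each box. The test point of `β` puts the basis vector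
  -- named by its letter into each box, so the product for `α` survives only if every column of `α`
  -- carries distinct letters of `β`. By rearrangement `β` then has smaller weight, unless the words
  -- agree.
  let word : ι → P → Fin d := fun α p => ((c α).symm p).2
  have hval : ∀ α β, (∏ j, e.det fun r => extend q (e ∘ word β) φ (q (c α (j, r)))) •
      G (extend q (e ∘ word β) φ) = (∏ j, e.det fun r => e (word β (c α (j, r)))) • G φ := by
    intro α β
    rw [hG _ fun i hi => extend_apply' _ _ _ hi]
    simp only [hq.extend_apply, comp_apply]
  refine linearIndependent_of_triangular _ (fun α => extend q (e ∘ word α) φ)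
    (fun α => ∑ p, h p * (word α p : ℕ)) ?_ ?_
  · intro α
    rw [hval]
    have : ∀ j r, word α (c α (j, r)) = r := by simp [word]
    simp only [this]
    simpa [e.det_self] using hφ
  · intro α β hne
    rw [hval] at hne
    have hinj : ∀ j, Injective fun r => word β (c α (j, r)) := by
      intro j
      by_contra hj
      refine hne ?_
      rw [prod_eq_zero (mem_univ j), zero_smul]
      exact e.det.map_eq_zero_of_not_injective _ fun hi => hj fun a b hab => hi (congrArg e hab)
    have hsum : ∀ γ, ∑ p, h p * (word γ p : ℕ) =
        ∑ j, ∑ r, h (c α (j, r)) * (word γ (c α (j, r)) : ℕ) := by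
      intro γ
      rw [← Fintype.sum_prod_type', ← Equiv.sum_comp (c α)]
    have hα : ∀ j r, word α (c α (j, r)) = r := by simp [word]
    by_cases hid : ∀ j, (fun r => word β (c α (j, r))) = id
    · left
      refine hword (funext fun p => ?_)
      obtain ⟨⟨j, r⟩, rfl⟩ := (c α).surjective p
      exact (congrFun (hid j) r).trans (hα j r).symm
    · right
      push Not at hid
      obtain ⟨j, hj⟩ := hid
      simp only [hsum, hα]
      refine sum_lt_sum (fun i _ => ?_)
        ⟨j, mem_univ j, sum_mul_lt_of_strictMono (hmono α j) (hinj j) hj⟩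
      by_cases hi : (fun r => word β (c α (i, r))) = id
      · exact le_of_eq (sum_congr rfl fun r _ => by rw [congrFun hi r]; rfl)
      · exact (sum_mul_lt_of_strictMono (hmono α i) (hinj i) hi).le

end Independence

/-! ### Counting balanced words: the central multinomial coefficient. -/

section BalancedWords

/-- The words in which every one of the `d` letters occurs exactly `m` times. -/
def balancedWords (m d : ℕ) : Finset (Fin m × Fin d → Fin d) :=
  univ.image fun (π : Equiv.Perm (Fin m × Fin d)) p => (π.symm p).2

/-- Permutations with the same word differ by one that preserves the letters, and there are
`m.factorial ^ d` of those. -/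
theorem factorial_le_mul_card_balancedWords (m d : ℕ) :
    (m * d).factorial ≤ m.factorial ^ d * (balancedWords m d).card := by
  have hstab : Fintype.card {τ : Equiv.Perm (Fin m × Fin d) // Prod.snd ∘ τ = Prod.snd} =
      m.factorial ^ d := by
    rw [DomMulAct.stabilizer_card]
    have : ∀ r : Fin d, Fintype.card {p : Fin m × Fin d // p.2 = r} = m := by
      intro r
      refine (Fintype.card_congr ?_).trans (Fintype.card_fin m)
      exact
        { toFun := fun p => p.1.1
          invFun := fun i => ⟨(i, r), rfl⟩
          left_inv := fun ⟨⟨i, r'⟩, h⟩ => by subst h; rfl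
          right_inv := fun i => rfl }
    simp [this]
  have hcard : (m * d).factorial = (univ : Finset (Equiv.Perm (Fin m × Fin d))).card := by
    rw [card_univ, Fintype.card_perm, Fintype.card_prod, Fintype.card_fin, Fintype.card_fin]
  rw [hcard]
  refine card_le_mul_card_image _ _ fun a ha => ?_
  obtain ⟨π₀, -, rfl⟩ := mem_image.1 ha
  rw [← hstab, ← Fintype.card_coe]
  refine Fintype.card_le_of_injective
    (fun π => ⟨π₀.trans π.1.symm, funext fun p => ?_⟩) fun π π' h => ?_
  · have := congrFun (mem_filter.1 π.2).2 (π₀ p)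
    simpa using this
  · have h' : π₀.trans π.1.symm = π₀.trans π'.1.symm := congrArg Subtype.val h
    refine Subtype.ext (Equiv.symm_bijective.injective (Equiv.ext fun p => ?_))
    simpa using congrArg (fun τ : Equiv.Perm (Fin m × Fin d) => τ (π₀.symm p)) h'

/-- With the previous count this shows that the balanced words miss `d ^ (d * m)` by at most a
factor polynomial in `m`. -/
theorem factorial_pow_mul_pow_le (m d : ℕ) (hm : 0 < m) :
    m.factorial ^ d * d ^ (d * m) ≤ (m * d).factorial * (m * d) ^ d := by
  induction m, hm using Nat.le_induction with
  | base => simpa using Nat.le_mul_of_pos_left _ d.factorial_pos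
  | succ m hm ih =>
    have h1 : (m * d).factorial * (m * d) ^ d ≤ ((m + 1) * d).factorial := by
      rw [add_mul, one_mul]
      exact (Nat.mul_le_mul_left _ (Nat.pow_le_pow_left (Nat.le_succ _) d)).trans
        Nat.factorial_mul_pow_le_factorial
    calc (m + 1).factorial ^ d * d ^ (d * (m + 1))
        = (m.factorial ^ d * d ^ (d * m)) * ((m + 1) * d) ^ d := by
          rw [Nat.factorial_succ, mul_pow, mul_pow, mul_add, mul_one, pow_add]; ring
      _ ≤ ((m * d).factorial * (m * d) ^ d) * ((m + 1) * d) ^ d := Nat.mul_le_mul_right _ ih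
      _ ≤ ((m + 1) * d).factorial * ((m + 1) * d) ^ d := Nat.mul_le_mul_right _ h1

theorem pow_le_card_balancedWords_mul (m d : ℕ) (hm : 0 < m) :
    d ^ (d * m) ≤ (balancedWords m d).card * (m * d) ^ d := by
  have h1 := factorial_pow_mul_pow_le m d hm
  have h2 := Nat.mul_le_mul_right ((m * d) ^ d) (factorial_le_mul_card_balancedWords m d)
  have h3 : 0 < m.factorial ^ d := pow_pos m.factorial_pos d
  rw [mul_assoc] at h2
  exact Nat.le_of_mul_le_mul_left (h1.trans h2) h3

end BalancedWords

/-! ### Shuffling the layers of a rectangular tableau. -/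

section Shuffle

variable {t m d : ℕ}

/-- The weight of a box in a rectangular tableau. -/
def boxWeight (p : (Fin t × Fin m) × Fin d) : ℕ := p.1.1 + p.2

/-- The map of boxes that permutes the `k`-th full layer of boxes of equal weight by `π k`. -/
def shuffle (π : Fin (t + 1 - d) → Equiv.Perm (Fin m × Fin d)) (p : (Fin t × Fin m) × Fin d) :
    (Fin t × Fin m) × Fin d :=
  -- These are the weights `w` for which `w - r` is a valid first coordinate for every row `r`. A
  -- box of such a layer is determined by its second coordinate and its row, so the layer is a copy
  -- of `Fin m × Fin d`.
  if h : d ≤ boxWeight p + 1 ∧ boxWeight p < t then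
    let q := π ⟨boxWeight p + 1 - d, by omega⟩ (p.1.2, p.2)
    ((⟨boxWeight p - q.2, by omega⟩, q.1), q.2)
  else p

/-- Preserving weights keeps the weights in each column strictly increasing, as the independence
criterion demands. -/
theorem boxWeight_shuffle (π : Fin (t + 1 - d) → Equiv.Perm (Fin m × Fin d))
    (p : (Fin t × Fin m) × Fin d) : boxWeight (shuffle π p) = boxWeight p := by
  by_cases h : d ≤ boxWeight p + 1 ∧ boxWeight p < t
  · rw [shuffle, dif_pos h]
    have := (π ⟨boxWeight p + 1 - d, by omega⟩ (p.1.2, p.2)).2.2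
    simp only [boxWeight] at h this ⊢
    omega
  · rw [shuffle, dif_neg h]

theorem shuffle_injective (π : Fin (t + 1 - d) → Equiv.Perm (Fin m × Fin d)) :
    Injective (shuffle π) := by
  intro p p' hpp
  have hw : boxWeight p = boxWeight p' := by
    rw [← boxWeight_shuffle π p, hpp, boxWeight_shuffle]
  by_cases h : d ≤ boxWeight p + 1 ∧ boxWeight p < t
  · have h' : d ≤ boxWeight p' + 1 ∧ boxWeight p' < t := hw ▸ h
    rw [shuffle, shuffle, dif_pos h, dif_pos h'] at hpp
    simp only [Prod.mk.injEq, hw] at hpp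
    have := (π _).injective (Prod.ext hpp.1.2 hpp.2)
    simp only [Prod.mk.injEq] at this
    simp only [boxWeight, this.2] at hw
    exact Prod.ext (Prod.ext (Fin.ext (by omega)) this.1) this.2
  · have h' : ¬ (d ≤ boxWeight p' + 1 ∧ boxWeight p' < t) := hw ▸ h
    rwa [shuffle, shuffle, dif_neg h, dif_neg h'] at hpp

/-- `shuffle` as a permutation of the boxes. -/
noncomputable def shuffleEquiv (π : Fin (t + 1 - d) → Equiv.Perm (Fin m × Fin d)) :
    Equiv.Perm ((Fin t × Fin m) × Fin d) :=
  Equiv.ofBijective (shuffle π) (Finite.injective_iff_bijective.1 (shuffle_injective π))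

/-- Along layer `k`, of weight `k + d - 1`, the word of the shuffle is the word of `π k`. Different
choices of words therefore give different words of the tableau. -/
theorem shuffleEquiv_symm_snd (π : Fin (t + 1 - d) → Equiv.Perm (Fin m × Fin d))
    (k : Fin (t + 1 - d)) (q : Fin m × Fin d) :
    ((shuffleEquiv π).symm ((⟨k + d - 1 - q.2, by omega⟩, q.1), q.2)).2 = ((π k).symm q).2 := by
  have hd : 0 < d := q.2.pos
  have hk := k.2
  let p : (Fin t × Fin m) × Fin d :=
    ((⟨k + d - 1 - ((π k).symm q).2, by omega⟩, ((π k).symm q).1), ((π k).symm q).2)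
  have hw : boxWeight p = k + d - 1 := by
    have := ((π k).symm q).2.2
    simp only [boxWeight, p]
    omega
  have hp : shuffleEquiv π p = ((⟨k + d - 1 - q.2, by omega⟩, q.1), q.2) := by
    have hk' : (⟨boxWeight p + 1 - d, by omega⟩ : Fin (t + 1 - d)) = k := Fin.ext (by simp; omega)
    have hq : π k (p.1.2, p.2) = q := (π k).apply_symm_apply q
    rw [shuffleEquiv, Equiv.ofBijective_apply, shuffle, dif_pos (by omega)]
    simp only [hk', hq]
    simp only [hw]
  rw [← hp, Equiv.symm_apply_apply]

end Shuffle

/-! ### The lower bound for the codimensions. -/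

section LowerBound

variable {F K L H : Type*} [Field F] [LieRing L] [LieAlgebra F L] [Ring H] [Algebra F H]
  [Field K] [LieAlgebra K L] {ρ : H →ₐ[F] Module.End F L} {d : ℕ} [Algebra F K]
  [IsScalarTower F K L]

/-- An `F`-basis of the polynomial functions still spans over `K`, so `K`-independent elements of
the `K`-span can be counted against an `F`-dimension. -/
theorem card_le_finrank_polyFun {s : Finset ℕ} [FiniteDimensional F (polyFun F ρ s)]
    {ι : Type*} [Fintype ι] {f : ι → (ℕ → L) → L} (hf : ∀ i, f i ∈ polyFun K ρ s)
    (hli : LinearIndependent K f) : Fintype.card ι ≤ finrank F (polyFun F ρ s) := by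
  let B := finBasis F (polyFun F ρ s)
  let W := Submodule.span K (Set.range fun i => (B i : (ℕ → L) → L))
  have hW : polyFun K ρ s ≤ W := by
    refine Submodule.span_le.2 fun g hg => ?_
    have hg' : g ∈ polyFun F ρ s := IsMonomialFun.mem_polyFun hg
    have : g = ∑ i, B.repr ⟨g, hg'⟩ i • (B i : (ℕ → L) → L) := by
      have := congrArg Subtype.val (B.sum_repr ⟨g, hg'⟩)
      rw [AddSubmonoidClass.coe_finsetSum] at this
      exact this.symm
    rw [this]
    refine sum_mem fun i _ => ?_
    rw [← algebraMap_smul K]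
    exact Submodule.smul_mem _ _ (Submodule.subset_span ⟨i, rfl⟩)
  have hli' : LinearIndependent K fun i => (⟨f i, hW (hf i)⟩ : W) :=
    LinearIndependent.of_comp W.subtype hli
  have : FiniteDimensional K W := FiniteDimensional.span_of_finite K (Set.finite_range _)
  refine hli'.fintype_card_le_finrank.trans ?_
  refine (finrank_range_le_card _).trans ?_
  rw [Fintype.card_fin]

theorem card_balancedWords_pow_le_finrank (hρ : IsGeneralizedAction ρ)
    (hK : ∀ (h : H) (c : K) (a : L), ρ h (c • a) = c • ρ h a)
    (hκ : (killingForm K L).Nondegenerate)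
    (hdense : ∀ T : Module.End K L, ∃ T' ∈ multiplicationAlgebra ρ, ∀ a, T' a = T a)
    [Nontrivial L] (e : Basis (Fin d) K L)
    (hfin : ∀ n, FiniteDimensional F (polyFun F ρ (range n))) :
    ∃ s₀ : ℕ, ∀ m t s : ℕ, s₀ ≤ s → Even t →
      (balancedWords m d).card ^ (t + 1 - d) ≤ finrank F (polyFun F ρ (range (t * m * d + s))) := by
  obtain ⟨s₀, hs₀⟩ := exists_prod_det_smul_mem_polyFun hρ hK hκ hdense e
  refine ⟨s₀, fun m t s hs ht => ?_⟩
  obtain ⟨G, hG, ⟨φ, hφ⟩, hmem⟩ := hs₀ (Ico (t * m * d) (t * m * d + s)) (by simpa using hs)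
  have hπ : ∀ w : balancedWords m d, ∃ π : Equiv.Perm (Fin m × Fin d),
      (fun p => (π.symm p).2) = w.1 := fun w => by
    obtain ⟨π, -, hπ⟩ := mem_image.1 w.2
    exact ⟨π, hπ⟩
  choose π hπ using hπ
  -- One balanced word is chosen freely for each full layer. The first `t * m * d` variables fill
  -- the boxes, and the remaining `s` are the variables of `G`.
  let c : (Fin (t + 1 - d) → balancedWords m d) → (Fin t × Fin m) × Fin d ≃
      (Fin t × Fin m) × Fin d := fun U => shuffleEquiv fun k => π (U k)
  let E : (Fin t × Fin m) × Fin d ≃ Fin (t * m * d) :=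
    (Equiv.prodCongr finProdFinEquiv (Equiv.refl _)).trans finProdFinEquiv
  let q : (Fin t × Fin m) × Fin d → ℕ := fun p => E p
  have hq : Injective q := Fin.val_injective.comp E.injective
  have hqlt : ∀ p, q p < t * m * d := fun p => (E p).2
  have hrange : ∀ U, univ.image (q ∘ c U) ∪ Ico (t * m * d) (t * m * d + s) =
      range (t * m * d + s) := by
    intro U
    ext j
    simp only [mem_union, mem_image, mem_univ, true_and, mem_Ico, mem_range, comp_apply]
    constructor
    · rintro (⟨p, rfl⟩ | h)
      · exact (hqlt _).trans_le (Nat.le_add_right _ _)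
      · exact h.2
    · intro hj
      by_cases hj' : j < t * m * d
      · exact Or.inl ⟨(c U).symm (E.symm ⟨j, hj'⟩), by simp [q]⟩
      · exact Or.inr ⟨not_lt.1 hj', hj⟩
  have hli := linearIndependent_prod_det (K := K) e boxWeight c (fun U j r r' hr => ?_)
    (fun U U' hU => ?_) q hq G φ hφ fun ψ hψ => hG fun i hi => hψ i ?_
  · have := hfin (t * m * d + s)
    refine le_trans (le_of_eq ?_) (card_le_finrank_polyFun (F := F) (ρ := ρ) (fun U => ?_) hli)
    · simp
    · have := hmem (c := q ∘ c U) (hq.comp (c U).injective) (fun p hp => ?_) ?_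
      · rwa [hrange] at this
      · exact absurd (hqlt (c U p)) (not_lt.2 (mem_Ico.1 hp).1)
      · rw [Fintype.card_prod, Fintype.card_fin]
        exact ht.mul_right _
  · change boxWeight (shuffle _ _) < boxWeight (shuffle _ _)
    rw [boxWeight_shuffle, boxWeight_shuffle]
    exact Nat.add_lt_add_left hr _
  · funext k
    refine Subtype.ext ?_
    rw [← hπ, ← hπ]
    funext p
    have := congrFun hU ((⟨k + d - 1 - p.2, by omega⟩, p.1), p.2)
    simp only [c] at this
    rwa [shuffleEquiv_symm_snd, shuffleEquiv_symm_snd] at this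
  · rintro ⟨p, rfl⟩
    exact absurd (hqlt p) (not_lt.2 (mem_Ico.1 hi).1)

end LowerBound

/-! ### The upper bound for the codimensions. -/

section UpperBound

variable {F K L H : Type*} [Field F] [LieRing L] [LieAlgebra F L] [Ring H] [Algebra F H]
  [Field K] [LieAlgebra K L] {ρ : H →ₐ[F] Module.End F L} {d : ℕ} [Algebra F K]
  [IsScalarTower F K L]

theorem polyFun_subset_polyFun {s : Finset ℕ} {f : (ℕ → L) → L} (hf : f ∈ polyFun F ρ s) :
    f ∈ polyFun K ρ s :=
  Submodule.span_le_restrictScalars F K _ hf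

/-- Polynomial functions are multilinear over `K`, not only over `F`, so their values on the `d ^ n`
tuples of `K`-basis vectors determine them. -/
theorem polyFun_finite_and_finrank_le [FiniteDimensional F L]
    (hK : ∀ (h : H) (c : K) (a : L), ρ h (c • a) = c • ρ h a)
    (e : Basis (Fin d) K L) (n : ℕ) :
    FiniteDimensional F (polyFun F ρ (range n)) ∧
      finrank F (polyFun F ρ (range n)) ≤ finrank F L * d ^ n := by
  let Φ : polyFun F ρ (range n) →ₗ[F] ((Fin n → Fin d) → L) :=
    { toFun := fun f w => f.1 (extend Fin.val (e ∘ w) 0)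
      map_add' := fun f g => rfl
      map_smul' := fun c f => rfl }
  have hΦ : Injective Φ := by
    rw [injective_iff_map_eq_zero]
    intro f hf
    refine Subtype.ext (funext fun φ => ?_)
    have hfK := polyFun_subset_polyFun (K := K) f.2
    let M := toMultilinearMap hK hfK (Fin.val : Fin n → ℕ) Fin.val_injective
      (fun i => mem_range.2 i.2) 0
    have hM : M = 0 := Basis.ext_multilinear (fun _ => e) fun w => congrFun hf w
    have h1 : f.1 φ = M (φ ∘ Fin.val) := by
      rw [toMultilinearMap_apply]
      refine congr_of_mem_polyFun f.2 fun i hi => ?_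
      exact (Fin.val_injective.extend_apply (φ ∘ Fin.val) 0 ⟨i, mem_range.1 hi⟩).symm
    rw [h1, hM]
    rfl
  refine ⟨Module.Finite.of_injective Φ hΦ, (LinearMap.finrank_le_finrank_of_injective hΦ).trans ?_⟩
  rw [Module.finrank_pi_fintype]
  simp [mul_comm]

end UpperBound

/-! ### Transitivity of the trace. -/

section TraceTower

variable {F K V : Type*} [Field F] [Field K] [Algebra F K] [AddCommGroup V] [Module F V]
  [Module K V] [IsScalarTower F K V]

theorem trace_restrictScalars [FiniteDimensional F K] [FiniteDimensional K V] (T : V →ₗ[K] V) :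
    LinearMap.trace F V (T.restrictScalars F) = Algebra.trace F K (LinearMap.trace K V T) := by
  let b := finBasis F K
  let e := finBasis K V
  rw [LinearMap.trace_eq_matrix_trace F (b.smulTower e), LinearMap.trace_eq_matrix_trace K e,
    Algebra.trace_apply, LinearMap.trace_eq_matrix_trace F b]
  simp only [Matrix.trace, Matrix.diag_apply, LinearMap.toMatrix_apply, Fintype.sum_prod_type]
  refine sum_congr rfl fun i _ => ?_
  simp [Basis.smulTower_repr, Basis.smulTower_apply, mul_comm]

end TraceTower

/-! ### The centroid and the growth of an `H`-simple algebra. -/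

section Centroid

variable {F L H : Type*} [Field F] [LieRing L] [LieAlgebra F L] [Ring H] [Algebra F H]
  {ρ : H →ₐ[F] Module.End F L}

theorem ad_mem_multiplicationAlgebra (ρ : H →ₐ[F] Module.End F L) (a : L) :
    LieAlgebra.ad F L a ∈ multiplicationAlgebra ρ :=
  Algebra.subset_adjoin (Or.inl ⟨a, rfl⟩)

theorem action_mem_multiplicationAlgebra (ρ : H →ₐ[F] Module.End F L) (h : H) :
    ρ h ∈ multiplicationAlgebra ρ :=
  Algebra.subset_adjoin (Or.inr ⟨h, rfl⟩)

theorem IsHSimple.exists_lie_ne_zero (hs : IsHSimple ρ) : ∃ a b : L, ⁅a, b⁆ ≠ 0 := by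
  by_contra! h
  exact hs.1 ⟨h⟩

/-- Submodules over the multiplication algebra are the same as `H`-invariant ideals. -/
theorem IsHSimple.isSimpleModule (hs : IsHSimple ρ) :
    IsSimpleModule (multiplicationAlgebra ρ) L := by
  obtain ⟨a, b, hab⟩ := hs.exists_lie_ne_zero
  have : Nontrivial L := ⟨_, _, hab⟩
  rw [isSimpleModule_iff]
  refine { exists_pair_ne := exists_pair_ne _, eq_bot_or_eq_top := fun N => ?_ }
  let I : LieIdeal F L :=
    { N.restrictScalars F with
      lie_mem := fun {x m} hm =>
        N.smul_mem ⟨LieAlgebra.ad F L x, ad_mem_multiplicationAlgebra ρ x⟩ hm }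
  have hI : ∀ x, x ∈ I ↔ x ∈ N := fun x => Iff.rfl
  rcases hs.2 I fun h x hx => N.smul_mem ⟨ρ h, action_mem_multiplicationAlgebra ρ h⟩ hx with h | h
  · left
    ext x
    rw [← hI, h]
    simp
  · right
    ext x
    rw [← hI, h]
    simp

/-- The operators commuting with the adjoint action and with `H`. -/
abbrev Centroid (ρ : H →ₐ[F] Module.End F L) : Type _ := Module.End (multiplicationAlgebra ρ) L

theorem Centroid.apply_lie (T : Centroid ρ) (a b : L) : T ⁅a, b⁆ = ⁅a, T b⁆ :=
  T.map_smul ⟨LieAlgebra.ad F L a, ad_mem_multiplicationAlgebra ρ a⟩ b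

theorem Centroid.apply_action (T : Centroid ρ) (h : H) (a : L) : T (ρ h a) = ρ h (T a) :=
  T.map_smul ⟨ρ h, action_mem_multiplicationAlgebra ρ h⟩ a

/-- Both `S * T` and `T * S` send `⁅a, b⁆` to `⁅S a, T b⁆`. The kernel of the commutator thus
contains a nonzero bracket and, by simplicity, is everything. -/
theorem IsHSimple.centroid_mul_comm (hs : IsHSimple ρ) (S T : Centroid ρ) : S * T = T * S := by
  have := hs.isSimpleModule
  have hlie : ∀ (S T : Centroid ρ) (a b : L), (S * T) ⁅a, b⁆ = ⁅S a, T b⁆ := by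
    intro S T a b
    rw [Module.End.mul_apply, T.apply_lie, ← lie_skew, map_neg, S.apply_lie, lie_skew]
  obtain ⟨a, b, hab⟩ := hs.exists_lie_ne_zero
  have hker : LinearMap.ker (S * T - T * S) = ⊤ := by
    refine (eq_bot_or_eq_top _).resolve_left fun h => hab ?_
    rw [← Submodule.mem_bot (multiplicationAlgebra ρ), ← h, LinearMap.mem_ker,
      LinearMap.sub_apply, hlie, ← lie_skew a b, map_neg, hlie, lie_skew, sub_self]
  exact sub_eq_zero.1 (LinearMap.ker_eq_top.1 hker)

open Classical in
/-- The centroid of an `H`-simple Lie algebra is a field. -/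
@[reducible] noncomputable def IsHSimple.centroidField (hs : IsHSimple ρ) : Field (Centroid ρ) :=
  letI := hs.isSimpleModule
  { (inferInstance : DivisionRing (Centroid ρ)) with mul_comm := hs.centroid_mul_comm }

theorem IsHSimple.exists_growth [FiniteDimensional F L] (hρ : IsGeneralizedAction ρ)
    (hs : IsHSimple ρ) (hκ : (killingForm F L).Nondegenerate) :
    ∃ d : ℕ, 0 < d ∧ (∀ n, hCodim ρ n ≤ finrank F L * d ^ n) ∧
      (∃ s₀, ∀ m t s : ℕ, s₀ ≤ s → Even t →
        (balancedWords m d).card ^ (t + 1 - d) ≤ hCodim ρ (t * m * d + s)) ∧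
      (IsHCentral ρ → d = finrank F L) := by
  have hsimple := hs.isSimpleModule
  let _ : Field (Centroid ρ) := hs.centroidField
  let _ : LieAlgebra (Centroid ρ) L :=
    { (inferInstance : Module (Centroid ρ) L) with
      lie_smul := fun T a b => (T.apply_lie a b).symm }
  have htower : IsScalarTower F (Centroid ρ) L := inferInstance
  have hfin : FiniteDimensional (Centroid ρ) L :=
    Module.Finite.of_restrictScalars_finite F (Centroid ρ) L
  have hnt : Nontrivial L := by
    obtain ⟨a, b, hab⟩ := hs.exists_lie_ne_zero
    exact ⟨_, _, hab⟩
  have hK : ∀ (h : H) (c : Centroid ρ) (a : L), ρ h (c • a) = c • ρ h a :=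
    fun h c a => (c.apply_action h a).symm
  -- Jacobson density for the simple module `L`, finite over its endomorphism field.
  have hdense : ∀ T : Module.End (Centroid ρ) L, ∃ T' ∈ multiplicationAlgebra ρ,
      ∀ a, T' a = T a := by
    intro T
    obtain ⟨T', hT'⟩ :=
      Module.Finite.toModuleEnd_moduleEnd_surjective (R := multiplicationAlgebra ρ) (M := L) T
    exact ⟨T'.1, T'.2, fun a => by rw [← hT']; rfl⟩
  have hfinK : FiniteDimensional F (Centroid ρ) := by
    obtain ⟨v, hv⟩ := exists_ne (0 : L)
    exact Module.Finite.of_injective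
      ((LinearMap.toSpanSingleton (Centroid ρ) L v).restrictScalars F)
      (smul_left_injective (Centroid ρ) hv)
  -- The Killing form over `F` is the field trace of the one over the centroid, so the radical of
  -- the latter lies in that of the former.
  have hκ' : (killingForm (Centroid ρ) L).Nondegenerate := by
    refine (LieModule.traceForm_isSymm
      (Centroid ρ) L L).isRefl.nondegenerate_iff_separatingLeft.mpr fun a ha => hκ.1 a fun b => ?_
    rw [killingForm_apply_apply]
    have htr := trace_restrictScalars (F := F)
      (LieAlgebra.ad (Centroid ρ) L a ∘ₗ LieAlgebra.ad (Centroid ρ) L b)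
    have hab : LinearMap.trace (Centroid ρ) L
      (LieAlgebra.ad (Centroid ρ) L a ∘ₗ LieAlgebra.ad (Centroid ρ) L b) = 0 := ha b
    rw [hab, map_zero] at htr
    exact htr
  let e := finBasis (Centroid ρ) L
  have hub := polyFun_finite_and_finrank_le (F := F) hK e
  obtain ⟨s₀, hs₀⟩ := card_balancedWords_pow_le_finrank hρ hK hκ' hdense e fun n => (hub n).1
  refine ⟨finrank (Centroid ρ) L, finrank_pos, fun n => ?_,
    ⟨s₀, fun m t s hs ht => ?_⟩, fun hc => ?_⟩
  · rw [hCodim_eq_finrank_polyFun]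
    exact (hub n).2
  · rw [hCodim_eq_finrank_polyFun]
    exact hs₀ m t s hs ht
  · have hone : finrank F (Centroid ρ) = 1 := by
      refine (finrank_eq_one_iff_of_nonzero' (1 : Centroid ρ) one_ne_zero).2 fun T => ?_
      obtain ⟨c, hc⟩ := hc (T.restrictScalars F) T.apply_lie T.apply_action
      exact ⟨c, LinearMap.ext fun a => (hc a).symm⟩
    rw [← finrank_mul_finrank F (Centroid ρ) L, hone, one_mul]

end Centroid

/-! ### From codimension bounds to the limit. -/

section Limit

theorem tendsto_rpow_of_codim_bounds {c : ℕ → ℕ} {d C : ℕ} (hd : 0 < d)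
    (hup : ∀ n, c n ≤ C * d ^ n)
    (hlow : ∃ s₀, ∀ m t s : ℕ, s₀ ≤ s → Even t →
      (balancedWords m d).card ^ (t + 1 - d) ≤ c (t * m * d + s)) :
    Tendsto (fun n : ℕ => (c n : ℝ) ^ (1 / (n : ℝ))) atTop (𝓝 (d : ℝ)) := by
  have hd' : (0 : ℝ) < d := by exact_mod_cast hd
  have hinv : Tendsto (fun n : ℕ => 1 / (n : ℝ)) atTop (𝓝 0) := tendsto_one_div_atTop_nhds_zero_nat
  refine tendsto_order.2 ⟨fun a ha => ?_, fun a ha => ?_⟩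
  · obtain ⟨s₀, hs₀⟩ := hlow
    -- The lower bound gives growth rate `x = B ^ (1 / (m * d))`, at least this quotient; so `m` is
    -- fixed first, with `x > a`.
    have hlim : Tendsto (fun m : ℕ => (d : ℝ) / ((m : ℝ) * d) ^ (1 / (m : ℝ))) atTop
        (𝓝 (d : ℝ)) := by
      have h1 : Tendsto (fun m : ℕ => (m : ℝ) ^ (1 / (m : ℝ))) atTop (𝓝 1) :=
        tendsto_rpow_div.comp tendsto_natCast_atTop_atTop
      have h2 : Tendsto (fun m : ℕ => (d : ℝ) ^ (1 / (m : ℝ))) atTop (𝓝 1) := by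
        simpa using (tendsto_const_nhds (x := (d : ℝ))).rpow hinv (Or.inl hd'.ne')
      have h3 := (tendsto_const_nhds (x := (d : ℝ))).div (h1.mul h2) (by norm_num)
      simp only [mul_one, div_one] at h3
      refine h3.congr fun m => ?_
      simp only [Pi.div_apply]
      rw [Real.mul_rpow (Nat.cast_nonneg m) hd'.le]
    obtain ⟨m, hma, hm⟩ := ((hlim.eventually (lt_mem_nhds ha)).and
      (eventually_gt_atTop 0)).exists
    have hm' : (0 : ℝ) < m := by exact_mod_cast hm
    set B := (balancedWords m d).card with hB
    have hBd : (d : ℝ) ^ (d * m) ≤ B * ((m : ℝ) * d) ^ d := by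
      exact_mod_cast pow_le_card_balancedWords_mul m d hm
    have hBpos : 0 < B := by
      rcases Nat.eq_zero_or_pos B with h0 | h0
      · rw [h0] at hBd
        have : (0 : ℝ) < (d : ℝ) ^ (d * m) := by positivity
        simp at hBd
        linarith
      · exact h0
    have hB1 : (1 : ℝ) ≤ B := by exact_mod_cast hBpos
    set x : ℝ := (B : ℝ) ^ (1 / ((m : ℝ) * d)) with hx
    have hx1 : 1 ≤ x := Real.one_le_rpow hB1 (by positivity)
    have hxpow : x ^ (m * d) = B := by
      rw [hx, ← Real.rpow_natCast, ← Real.rpow_mul (by positivity)]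
      push_cast
      rw [one_div_mul_cancel (by positivity), Real.rpow_one]
    have hax : a < x := by
      refine hma.trans_le ?_
      rw [div_le_iff₀ (by positivity)]
      refine le_of_pow_le_pow_left₀ (mul_pos hm hd).ne' (by positivity) ?_
      have : (((m : ℝ) * d) ^ (1 / (m : ℝ))) ^ (m * d) = ((m : ℝ) * d) ^ d := by
        rw [pow_mul, ← Real.rpow_natCast _ m, ← Real.rpow_mul (by positivity),
          one_div_mul_cancel hm'.ne', Real.rpow_one]
      rw [mul_pow, hxpow, this, mul_comm m d]
      exact hBd
    -- The loss in the exponent: `s₀` reserved variables, the remainder on division by `2 * m * d`,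
    -- and the incomplete layers.
    set C₀ : ℝ := s₀ + 2 * m * d + m * d * d with hC₀
    have hlim' : Tendsto (fun n : ℕ => x ^ (1 - C₀ * (1 / (n : ℝ)))) atTop (𝓝 x) := by
      have h1 : Tendsto (fun n : ℕ => 1 - C₀ * (1 / (n : ℝ))) atTop (𝓝 1) := by
        simpa using (tendsto_const_nhds (x := (1 : ℝ))).sub (hinv.const_mul C₀)
      simpa using (tendsto_const_nhds (x := x)).rpow h1 (Or.inl (by positivity))
    filter_upwards [hlim'.eventually (lt_mem_nhds hax), eventually_ge_atTop s₀,
      eventually_gt_atTop 0] with n hn hns hn0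
    refine hn.trans_le ?_
    have hn0' : (0 : ℝ) < n := by exact_mod_cast hn0
    set q := (n - s₀) / (2 * (m * d)) with hq
    have hdm := Nat.div_add_mod (n - s₀) (2 * (m * d))
    have hmod := Nat.mod_lt (n - s₀) (show 0 < 2 * (m * d) by positivity)
    rw [← hq] at hdm
    have htm : 2 * q * m * d = 2 * (m * d) * q := by ring
    have hc := hs₀ m (2 * q) (n - 2 * q * m * d) (by omega) (even_two_mul q)
    rw [show 2 * q * m * d + (n - 2 * q * m * d) = n by omega, ← hB] at hc
    have hexp : (n : ℝ) - C₀ ≤ ((m * d * (2 * q + 1 - d) : ℕ) : ℝ) := by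
      have h1 : ((2 * q : ℕ) : ℝ) - d ≤ ((2 * q + 1 - d : ℕ) : ℝ) := by
        have : 2 * q ≤ (2 * q + 1 - d) + d := by omega
        have : ((2 * q : ℕ) : ℝ) ≤ ((2 * q + 1 - d : ℕ) : ℝ) + d := by exact_mod_cast this
        linarith
      have h2 : (n : ℝ) ≤ s₀ + 2 * (m * d) * q + 2 * (m * d) := by
        have : n ≤ s₀ + 2 * (m * d) * q + 2 * (m * d) := by omega
        exact_mod_cast this
      have h3 := mul_le_mul_of_nonneg_left h1 (show (0 : ℝ) ≤ m * d by positivity)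
      push_cast at h3 ⊢
      rw [hC₀]
      linarith
    have hle : x ^ ((n : ℝ) - C₀) ≤ c n := by
      calc x ^ ((n : ℝ) - C₀) ≤ x ^ ((m * d * (2 * q + 1 - d) : ℕ) : ℝ) :=
            Real.rpow_le_rpow_of_exponent_le hx1 hexp
        _ = (B : ℝ) ^ (2 * q + 1 - d) := by rw [Real.rpow_natCast, pow_mul, hxpow]
        _ ≤ c n := by exact_mod_cast hc
    calc x ^ (1 - C₀ * (1 / (n : ℝ))) = (x ^ ((n : ℝ) - C₀)) ^ (1 / (n : ℝ)) := by
          rw [← Real.rpow_mul (zero_le_one.trans hx1) ((n : ℝ) - C₀), sub_mul,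
            mul_one_div_cancel hn0'.ne']
      _ ≤ (c n : ℝ) ^ (1 / (n : ℝ)) :=
          Real.rpow_le_rpow (by positivity) hle (by positivity)
  · have hlim : Tendsto (fun n : ℕ => ((C : ℝ) + 1) ^ (1 / (n : ℝ)) * d) atTop (𝓝 (d : ℝ)) := by
      have h1 := (tendsto_const_nhds (x := (C : ℝ) + 1)).rpow hinv (Or.inl (by positivity))
      simpa using h1.mul_const (d : ℝ)
    filter_upwards [hlim.eventually (gt_mem_nhds ha), eventually_gt_atTop 0] with n hn hn0
    refine lt_of_le_of_lt ?_ hn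
    have hn0' : (n : ℝ) ≠ 0 := by exact_mod_cast hn0.ne'
    have h1 : (c n : ℝ) ≤ ((C : ℝ) + 1) * (d : ℝ) ^ n := by
      have : (c n : ℝ) ≤ C * (d : ℝ) ^ n := by exact_mod_cast hup n
      have : (0 : ℝ) ≤ (d : ℝ) ^ n := by positivity
      linarith
    calc (c n : ℝ) ^ (1 / (n : ℝ)) ≤ (((C : ℝ) + 1) * (d : ℝ) ^ n) ^ (1 / (n : ℝ)) :=
          Real.rpow_le_rpow (by positivity) h1 (by positivity)
      _ = ((C : ℝ) + 1) ^ (1 / (n : ℝ)) * d := by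
          rw [Real.mul_rpow (by positivity) (by positivity), ← Real.rpow_natCast (d : ℝ) n,
            ← Real.rpow_mul hd'.le, mul_one_div_cancel hn0', Real.rpow_one]

end Limit

/-! ### Reduction to the `H`-simple summands. -/

section InvariantIdeals

variable {F L H : Type*} [Field F] [LieRing L] [LieAlgebra F L] [Ring H] [Algebra F H]
  {ρ : H →ₐ[F] Module.End F L}

theorem IsGeneralizedAction.restrictAction (hρ : IsGeneralizedAction ρ) (I : LieIdeal F L)
    (hI : IsHInvariant ρ I) : IsGeneralizedAction (restrictAction ρ I hI) := by
  intro h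
  obtain ⟨k, h', h'', hk⟩ := hρ h
  refine ⟨k, h', h'', fun a b => Subtype.ext ?_⟩
  have := hk a b
  rw [AddSubmonoidClass.coe_finsetSum]
  exact this

theorem evalAt_coe (I : LieIdeal F L) (hI : IsHInvariant ρ I) (φ : ℕ → I) (f : HPoly F H) :
    evalAt ρ (fun j => (φ j : L)) f = (evalAt (restrictAction ρ I hI) φ f : L) := by
  have : evalAt ρ (fun j => (φ j : L)) = I.incl.comp (evalAt (restrictAction ρ I hI) φ) := by
    refine FreeLieAlgebra.hom_ext ?_
    intro p
    simp only [evalAt, LieHom.comp_apply, FreeLieAlgebra.lift_of_apply]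
    rfl
  rw [this]
  rfl

variable (F) in
/-- Restriction of functions to substitutions with values in `I`. -/
def restrictToIdeal (I : LieIdeal F L) : ((ℕ → L) → L) →ₗ[F] ((ℕ → I) → L) where
  toFun f φ := f fun j => (φ j : L)
  map_add' _ _ := rfl
  map_smul' _ _ := rfl

variable (F) in
/-- Functions with values in `I` considered as functions with values in `L`. -/
def coeFromIdeal (I : LieIdeal F L) : ((ℕ → I) → I) →ₗ[F] ((ℕ → I) → L) where
  toFun f φ := f φ
  map_add' _ _ := rfl
  map_smul' _ _ := rfl

theorem coeFromIdeal_injective (I : LieIdeal F L) : Injective (coeFromIdeal F I) :=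
  fun _ _ h => funext fun φ => Subtype.ext (congrFun h φ)

/-- Both sides are the evaluations of the same `H`-polynomials on `I`. -/
theorem map_restrictToIdeal_polyFun (I : LieIdeal F L) (hI : IsHInvariant ρ I) (n : ℕ) :
    (polyFun F ρ (range n)).map (restrictToIdeal F I) =
      (polyFun F (restrictAction ρ I hI) (range n)).map (coeFromIdeal F I) := by
  rw [← map_evalLinear_multilinearPart, ← map_evalLinear_multilinearPart, ← Submodule.map_comp,
    ← Submodule.map_comp]
  congr 1
  exact LinearMap.ext fun f => funext fun φ => evalAt_coe I hI φ f

theorem finrank_map_coeFromIdeal (I : LieIdeal F L) (hI : IsHInvariant ρ I) (n : ℕ) :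
    finrank F ((polyFun F (restrictAction ρ I hI) (range n)).map (coeFromIdeal F I)) =
      hCodim (restrictAction ρ I hI) n := by
  rw [hCodim_eq_finrank_polyFun]
  exact (Submodule.equivMapOfInjective _ (coeFromIdeal_injective I) _).finrank_eq.symm

theorem finiteDimensional_polyFun [FiniteDimensional F L] (ρ : H →ₐ[F] Module.End F L) (n : ℕ) :
    FiniteDimensional F (polyFun F ρ (range n)) :=
  (polyFun_finite_and_finrank_le (K := F) (fun h c a => (ρ h).map_smul c a)
    (finBasis F L) n).1

theorem hCodim_restrictAction_le [FiniteDimensional F L] (I : LieIdeal F L)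
    (hI : IsHInvariant ρ I) (n : ℕ) : hCodim (restrictAction ρ I hI) n ≤ hCodim ρ n := by
  have := finiteDimensional_polyFun ρ n
  rw [← finrank_map_coeFromIdeal, ← map_restrictToIdeal_polyFun, hCodim_eq_finrank_polyFun ρ n]
  exact Submodule.finrank_map_le _ _

theorem IsMonomialFun.apply_mem {s : Finset ℕ} {f : (ℕ → L) → L} (hf : IsMonomialFun ρ s f)
    (I : LieIdeal F L) (hI : IsHInvariant ρ I) {φ : ℕ → L} (hφ : ∀ j, φ j ∈ I) : f φ ∈ I := by
  induction hf with
  | var i h => exact hI h _ (hφ i)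
  | lie _ _ _ _ ihg => exact I.lie_mem ihg

variable {m : ℕ} {I : Fin m → LieIdeal F L}

theorem lie_eq_zero_of_isInternal (hsum : DirectSum.IsInternal fun i => (I i).toSubmodule)
    {i j : Fin m} (hij : i ≠ j) {a b : L} (ha : a ∈ I i) (hb : b ∈ I j) : ⁅a, b⁆ = 0 := by
  have hdisj := hsum.submodule_iSupIndep.pairwiseDisjoint hij
  have h1 : ⁅a, b⁆ ∈ (I i).toSubmodule := lie_mem_left F L (I i) a b ha
  have h2 : ⁅a, b⁆ ∈ (I j).toSubmodule := (I j).lie_mem hb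
  exact Submodule.disjoint_def.1 hdisj _ h1 h2

/-- Brackets between different summands vanish, so polynomial functions act componentwise. -/
theorem apply_sum_of_mem_polyFun (hsum : DirectSum.IsInternal fun i => (I i).toSubmodule)
    (hinv : ∀ i, IsHInvariant ρ (I i)) {s : Finset ℕ} {f : (ℕ → L) → L}
    (hf : f ∈ polyFun F ρ s) {y : Fin m → ℕ → L} (hy : ∀ i j, y i j ∈ I i) :
    f (∑ i, y i) = ∑ i, f (y i) := by
  induction hf using Submodule.span_induction with
  | mem f hf =>
    simp only [Set.mem_ofPred_eq] at hf
    induction hf with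
    | var i h => simp
    | @lie s t f g _ hf hg ihf ihg =>
      simp only [ihf, ihg, sum_lie, lie_sum]
      refine sum_congr rfl fun i _ => Finset.sum_eq_single i (fun j _ hji => ?_) (by simp)
      exact lie_eq_zero_of_isInternal hsum hji (hf.apply_mem _ (hinv j) (hy j))
        (hg.apply_mem _ (hinv i) (hy i))
  | zero => simp
  | add f g _ _ hf hg => simp [hf, hg, sum_add_distrib]
  | smul c f _ hf => simp [hf, smul_sum]

/-- By the componentwise formula, a polynomial function is determined by its restrictions to the
summands. -/
theorem hCodim_le_sum [FiniteDimensional F L]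
    (hsum : DirectSum.IsInternal fun i => (I i).toSubmodule)
    (hinv : ∀ i, IsHInvariant ρ (I i)) (n : ℕ) :
    hCodim ρ n ≤ ∑ i, hCodim (restrictAction ρ (I i) (hinv i)) n := by
  classical
  have hfin := finiteDimensional_polyFun ρ n
  let Θ : polyFun F ρ (range n) →ₗ[F] ∀ i, (polyFun F ρ (range n)).map (restrictToIdeal F (I i)) :=
    LinearMap.pi fun i => ((restrictToIdeal F (I i)).domRestrict _).codRestrict _
      fun f => Submodule.mem_map_of_mem f.2
  have hΘ : Injective Θ := by
    rw [injective_iff_map_eq_zero]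
    intro f hf
    refine Subtype.ext (funext fun φ => ?_)
    have hdec : ∀ j, ∃ y : Fin m → L, (∀ i, y i ∈ I i) ∧ ∑ i, y i = φ j := by
      intro j
      obtain ⟨y, hy⟩ := hsum.2 (φ j)
      refine ⟨fun i => y i, fun i => (y i).2, ?_⟩
      rw [← hy, DirectSum.coeAddMonoidHom_eq_dfinsuppSum, DFinsupp.sum_eq_sum_fintype]
      · rfl
      · exact fun i => rfl
    choose y hy hyφ using hdec
    have hφ : φ = ∑ i, fun j => y j i := by
      ext j
      rw [Finset.sum_apply, hyφ]
    rw [hφ, apply_sum_of_mem_polyFun hsum hinv f.2 fun i j => hy j i]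
    refine sum_eq_zero fun i _ => ?_
    have := congrFun (congrArg Subtype.val (congrFun hf i)) fun j => ⟨y j i, hy j i⟩
    exact this
  rw [hCodim_eq_finrank_polyFun]
  refine (LinearMap.finrank_le_finrank_of_injective hΘ).trans (le_of_eq ?_)
  rw [Module.finrank_pi_fintype]
  refine sum_congr rfl fun i _ => ?_
  rw [map_restrictToIdeal_polyFun (I i) (hinv i), finrank_map_coeFromIdeal]

/-- The Killing form of an ideal is the restriction of that of `L`, and an ideal meets its Killing
complement trivially. -/
theorem killingForm_ideal_nondegenerate [FiniteDimensional F L] [LieAlgebra.IsKilling F L]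
    (I : LieIdeal F L) : (killingForm F I).Nondegenerate := by
  refine (LieModule.traceForm_isSymm F I I).isRefl.nondegenerate_iff_separatingLeft.mpr
    fun a ha => Subtype.ext ?_
  have hdisj := (LieIdeal.isCompl_killingCompl I).disjoint
  have hmem : (a : L) ∈ I ⊓ I.killingCompl := by
    refine ⟨a.2, I.mem_killingCompl.2 fun b hb => ?_⟩
    have : killingForm F I a ⟨b, hb⟩ = 0 := ha ⟨b, hb⟩
    rw [LieIdeal.killingForm_eq] at this
    rw [LieModule.traceForm_comm]
    exact this
  rw [hdisj.eq_bot] at hmem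
  simpa using hmem

/-- Schur's lemma: an eigenspace of `T` is a nonzero `H`-invariant ideal. -/
theorem IsHSimple.isHCentral [IsAlgClosed F] [FiniteDimensional F L] (hs : IsHSimple ρ) :
    IsHCentral ρ := by
  intro T hT hTρ
  obtain ⟨a, b, hab⟩ := hs.exists_lie_ne_zero
  have : Nontrivial L := ⟨_, _, hab⟩
  obtain ⟨c, hc⟩ := Module.End.exists_eigenvalue T
  obtain ⟨v, hv, hv0⟩ := hc.exists_hasEigenvector
  let J : LieIdeal F L :=
    { LinearMap.ker (T - algebraMap F _ c) with
      lie_mem := fun {x y} hy => by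
        have hy' : (T - algebraMap F _ c) y = 0 := hy
        change (T - algebraMap F _ c) ⁅x, y⁆ = 0
        simp only [LinearMap.sub_apply, Module.algebraMap_end_apply] at hy' ⊢
        rw [hT, ← lie_smul, ← lie_sub, hy', lie_zero] }
  have hJ : ∀ x, x ∈ J ↔ T x = c • x := fun x => by
    change (T - algebraMap F _ c) x = 0 ↔ _
    simp [sub_eq_zero]
  rcases hs.2 J fun h x hx => by rw [hJ] at hx ⊢; rw [hTρ, hx, map_smul] with h | h
  · refine absurd ?_ hv0
    have : v ∈ J := (hJ v).2 (Module.End.mem_eigenspace_iff.1 hv)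
    simpa [h] using this
  · exact ⟨c, fun x => (hJ x).1 (h ▸ LieSubmodule.mem_top x)⟩

end InvariantIdeals

end HLie

/-! ### The exponent of an `H`-semisimple algebra. -/

open HLie in
theorem mainTheorem3 {F L H : Type*} [Field F] [CharZero F]
    [LieRing L] [LieAlgebra F L] [FiniteDimensional F L] [LieAlgebra.HasTrivialRadical F L]
    [Ring H] [Algebra F H]
    (ρ : H →ₐ[F] Module.End F L) (hρ : HLie.IsGeneralizedAction ρ)
    {m : ℕ} (I : Fin m → LieIdeal F L)
    (hsum : DirectSum.IsInternal fun i => (I i).toSubmodule)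
    (hinv : ∀ i, HLie.IsHInvariant ρ (I i))
    (hsimple : ∀ i, HLie.IsHSimple (HLie.restrictAction ρ (I i) (hinv i))) :
    (∃ d : ℕ, HLie.HasHExponent ρ d) ∧
    (IsAlgClosed F →
      HLie.HasHExponent ρ (Finset.univ.sup fun i => Module.finrank F (I i) : ℕ)) ∧
    ((∀ i, HLie.IsHCentral (HLie.restrictAction ρ (I i) (hinv i))) →
      HLie.HasHExponent ρ (Finset.univ.sup fun i => Module.finrank F (I i) : ℕ)) := by
  choose d hd hup hlow hcent using fun i => (hsimple i).exists_growth
    (hρ.restrictAction (I i) (hinv i)) (killingForm_ideal_nondegenerate (I i))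
  have hexp : HasHExponent ρ (Finset.univ.sup d : ℕ) := by
    rcases isEmpty_or_nonempty (Fin m) with hm | hm
    · have hzero : ∀ n, hCodim ρ n = 0 := fun n => by
        simpa using hCodim_le_sum hsum hinv n
      refine tendsto_const_nhds.congr' ?_
      -- At `n = 0` the exponent `1 / 0` is `0` and the root is `0 ^ 0 = 1`, so only `n > 0` is
      -- used.
      filter_upwards [Filter.eventually_gt_atTop 0] with n hn
      have hn' : (n : ℝ) ≠ 0 := by exact_mod_cast hn.ne'
      rw [hzero]
      simp [Real.zero_rpow (inv_ne_zero hn')]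
    · obtain ⟨i, -, hi⟩ := Finset.exists_mem_eq_sup Finset.univ Finset.univ_nonempty d
      refine tendsto_rpow_of_codim_bounds (C := ∑ j, Module.finrank F (I j)) (hi ▸ hd i)
        (fun n => (hCodim_le_sum hsum hinv n).trans ?_) ?_
      · rw [Finset.sum_mul]
        exact Finset.sum_le_sum fun j _ => (hup j n).trans
          (Nat.mul_le_mul_left _ (Nat.pow_le_pow_left (Finset.le_sup (Finset.mem_univ j)) n))
      · obtain ⟨s₀, hs₀⟩ := hlow i
        rw [hi]
        exact ⟨s₀, fun m t s hs ht => (hs₀ m t s hs ht).trans (hCodim_restrictAction_le _ _ _)⟩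
  have hcentral : (∀ i, IsHCentral (restrictAction ρ (I i) (hinv i))) →
      HasHExponent ρ (Finset.univ.sup fun i => Module.finrank F (I i) : ℕ) := fun h => by
    rwa [← funext fun i => hcent i (h i)]
  exact ⟨⟨_, hexp⟩, fun _ => hcentral fun i => (hsimple i).isHCentral, hcentral⟩
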